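/- **Setting.** Let $K\ge 1$, $\sigma\ge 0$, $D>0$, and write $[K]=\{1,\dots,K\}$. Let $\Sigma=(\sigma_{ij}^2)_{i,j\in[K]}$ with $\sigma_{ij}\in\{\sigma,\infty\}$, let $S_i=\{j:\sigma_{ij}<\infty\}$, and assume that for every $j$ there is an $i$ with $\sigma_{ij}\le\sigma$. The learner knows $\Sigma,\sigma,D$, but not $\theta\in\Theta=[0,D]^K$. When it plays action $i$ in round $t$ it observes, for each $j\in S_i$, a sample $X_{t,i,j}\sim N(\theta_j,\sigma^2)$; for fixed $(t,i)$ the coordinates $X_{t,i,j}$ are independent, and the families $X_t=(X_{t,i,j})_{i\in[K],\,j\in S_i}$ are independent over $t$. Let $d_i(\theta)=\max_j\theta_j-\theta_i$, let $N_i(T)$ be the number of plays of $i$ in the first $T$ rounds, and let $R_T(\theta)=\sum_i N_i(T)\,d_i(\theta)$ (the regret without expectation). An action $i$ is strongly observable if $i\in S_i$ or $i\in S_j$ for all $j\ne i$; it is weakly observable if it is not strongly observable but $i\in S_j$ for some $j$. Let $\mathcal W(\Sigma)$ be the set of weakly observable actions; $\Sigma$ is strongly observable if $\mathcal W(\Sigma)=\emptyset$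 and weakly observable otherwise. $\kappa(\Sigma)$ is the largest size of a set $A\subset[K]$ with $S_i\cap A\subset\{i\}$ for all $i\in A$. $\rho(\Sigma)$ is the smallest size of a set $A\subset[K]$ such that every $j\in\mathcal W(\Sigma)$ lies in $S_i$ for some $i\in A$. **Algorithm 2** (inputs $\Sigma$, $\delta$). For $A,A'\subset[K]$, $A\neq\emptyset$, let $\Delta^A$ be the set of probability vectors on $[K]$ supported on $A$, let $c(A,A')\in\operatorname{argmax}_{c\in\Delta^A}\min_{i\in A'}\sum_{j:i\in S_j}c_j$ (ties broken by an arbitrary fixed rule, $\min\emptyset=\infty$), and let $m(A,A')$ be the maximum. Let $A^{\mathcal S}=\{i\in A:\exists j\in A,\ i\in S_j\}$ and $A^{\mathcal W}=A\setminus A^{\mathcal S}$. Start with $t_1=0$ and $A_1=[K]$. Proceed in phases $r=1,2,\dots$, where $n_i(r)$ is the number of observations of action $i$ made in the phases before $r$, $\hat\theta_{i,r}$ is their average, and $g_{i,r}(\delta)=\sigma\sqrt{2\log(8K^2r^3/\delta)/n_i(r)}$. If $|A_r|=1$, play the only action of $A_r$ in all remaining rounds. Otherwise let $\alpha_r=\min\{m([K],A_s^{\mathcal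 W}): 1\le s\le r,\ A_s^{\mathcal W}\ne\emptyset\}$ ($\alpha_r=1$ if there is no such $s$) and $\gamma(r)=(\sigma\alpha_rt_r/D)^{2/3}$. If $A_r^{\mathcal W}\neq\emptyset$, $\min_{i\in A_r^{\mathcal W}}n_i(r)<\min_{i\in A_r^{\mathcal S}}n_i(r)$ and $\min_{i\in A_r^{\mathcal W}}n_i(r)<\gamma(r)$, set $c_r=c([K],A_r^{\mathcal W})$; otherwise set $c_r=c(A_r,A_r^{\mathcal S})$. Play each action $j$ exactly $i_{r,j}=\lceil c_{r,j}\|c_r\|_0\rceil$ times, where $\|c_r\|_0$ is the number of non-zero coordinates of $c_r$ (in an order that may depend on $r$ and on the vector $i_r$; plays beyond round $T$ are cut off). Set $t_{r+1}=t_r+\sum_j i_{r,j}$ and $$A_{r+1}=\Big\{i\in A_r:\ \hat\theta_{i,r+1}+g_{i,r+1}(\delta)\ \ge\ \max_{j\in A_r}\big(\hat\theta_{j,r+1}-g_{j,r+1}(\delta)\big)\Big\}.$$ **Theorem.** For every $\delta\in(0,1)$, every $\theta\in\Theta$ and every horizon $T$, the regret of Algorithm 2 satisfies the following. 1. If $\Sigma$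 is weakly observable, then with probability at least $1-\delta$, $$R_T(\theta)\le(\rho(\Sigma)D)^{1/3}(\sigma T)^{2/3}\cdot7\sqrt{6\log\frac{2KT}{\delta}}+\frac{125\,\sigma^2K^3}{D}+13K^3D .$$ 2. If $\Sigma$ is strongly observable, then with probability at least $1-\delta$, $$R_T(\theta)\le 2KD+80\,\sigma\sqrt{\kappa(\Sigma)\,T\cdot 6\log K\,\log\frac{2KT}{\delta}} .$$ (For $T=0$, where $R_0(\theta)=0$, the terms that contain $T$ are read as $0$.) -/

import Mathlib

open MeasureTheory ProbabilityTheory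
open scoped ENNReal

namespace SideObs

noncomputable section

/-! ### The feedback structure -/

/-- `S_i = {j : σ_{ij} < ∞}`: the actions whose parameter is observed when `i` is played.
`sd i j = σ_{ij}` is the (possibly infinite) standard deviation. -/
def obsSet {K : ℕ} (sd : Fin K → Fin K → ℝ≥0∞) (i : Fin K) : Finset (Fin K) :=
  open Classical in Finset.univ.filter fun j => sd i j < ⊤

/-- `i` is strongly observable: it observes itself, or every other action observes it. -/
def StronglyObservableAction {K : ℕ} (sd : Fin K → Fin K → ℝ≥0∞) (i : Fin K) : Prop :=
  i ∈ obsSet sd i ∨ ∀ j, j ≠ i → i ∈ obsSet sd j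

/-- `i` is weakly observable: observable, but not strongly. -/
def WeaklyObservableAction {K : ℕ} (sd : Fin K → Fin K → ℝ≥0∞) (i : Fin K) : Prop :=
  ¬ StronglyObservableAction sd i ∧ ∃ j, i ∈ obsSet sd j

/-- `W(Σ)`, the set of weakly observable actions. -/
def weakSet {K : ℕ} (sd : Fin K → Fin K → ℝ≥0∞) : Finset (Fin K) :=
  open Classical in Finset.univ.filter (WeaklyObservableAction sd)

def StronglyObservable {K : ℕ} (sd : Fin K → Fin K → ℝ≥0∞) : Prop := weakSet sd = ∅

def WeaklyObservable {K : ℕ} (sd : Fin K → Fin K → ℝ≥0∞) : Prop := weakSet sd ≠ ∅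

/-- `A` is independent if `S_i ∩ A ⊆ {i}` for all `i ∈ A`. -/
def IsIndependent {K : ℕ} (sd : Fin K → Fin K → ℝ≥0∞) (A : Finset (Fin K)) : Prop :=
  ∀ i ∈ A, obsSet sd i ∩ A ⊆ {i}

/-- The independence number `κ(Σ)`. -/
def independenceNumber {K : ℕ} (sd : Fin K → Fin K → ℝ≥0∞) : ℕ :=
  open Classical in
  ((Finset.univ : Finset (Finset (Fin K))).filter (IsIndependent sd)).sup Finset.card

/-- `A` dominates `A'`: every `j ∈ A'` is observed by some `i ∈ A`. -/
def Dominates {K : ℕ} (sd : Fin K → Fin K → ℝ≥0∞) (A A' : Finset (Fin K)) : Prop :=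
  ∀ j ∈ A', ∃ i ∈ A, j ∈ obsSet sd i

/-- The weak domination number `ρ(Σ)`: the least size of a set that dominates `W(Σ)`. -/
def weakDominationNumber {K : ℕ} (sd : Fin K → Fin K → ℝ≥0∞) : ℕ :=
  sInf {n | ∃ A : Finset (Fin K), Dominates sd A (weakSet sd) ∧ A.card = n}

/-! ### The stochastic environment -/

/-- `X t i j` is the `j`-th coordinate of the observation vector produced by action `i` in
round `t`; rounds are numbered from `0`. Only the coordinates with `σ_{ij} < ∞` carry
information, and only those are constrained. Nothing is assumed on the joint law of
`X t i` and `X t i'` for two different actions in the same round. -/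
structure IsEnvironment {Ω : Type*} [MeasurableSpace Ω] (μ : Measure Ω) {K : ℕ}
    (sd : Fin K → Fin K → ℝ≥0∞) (θ : Fin K → ℝ) (X : ℕ → Fin K → Fin K → Ω → ℝ) : Prop where
  measurable : ∀ t i, ∀ j ∈ obsSet sd i, Measurable (X t i j)
  law : ∀ t i, ∀ j ∈ obsSet sd i,
    μ.map (X t i j) = gaussianReal (θ j) ((sd i j) ^ 2).toNNReal
  indep_coord : ∀ t i, iIndepFun (fun (j : {j // j ∈ obsSet sd i}) => X t i j) μ
  indep_rounds :
    iIndepFun (fun (t : ℕ) (ω : Ω) (p : {p : Fin K × Fin K // p.2 ∈ obsSet sd p.1}) =>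
      X t p.1.1 p.1.2 ω) μ

/-! ### Maximin exploration -/

/-- The simplex `Δ^A`: probability vectors supported on `A`. -/
def simplexOn {K : ℕ} (A : Finset (Fin K)) : Set (Fin K → ℝ) :=
  {c | (∀ j, 0 ≤ c j) ∧ (∀ j, j ∉ A → c j = 0) ∧ ∑ j, c j = 1}

/-- `min_{i ∈ A'} ∑_{j : i ∈ S_j} c_j`. For empty `A'` the value is a constant (here `0`), so that
every `c` is a maximizer then, as with the convention `min ∅ = ∞`. -/
def coverage {K : ℕ} (sd : Fin K → Fin K → ℝ≥0∞) (A' : Finset (Fin K)) (c : Fin K → ℝ) : ℝ :=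
  if h : A'.Nonempty then
    A'.inf' h (fun i => ∑ j ∈ Finset.univ.filter (fun j => i ∈ obsSet sd j), c j)
  else 0

/-- `c` is a selection rule for `c(A, A') ∈ argmax_{c ∈ Δ^A} min_{i ∈ A'} ∑_{j : i ∈ S_j} c_j`.
Every way of breaking ties is such a rule. -/
def IsMaximinRule {K : ℕ} (sd : Fin K → Fin K → ℝ≥0∞)
    (c : Finset (Fin K) → Finset (Fin K) → Fin K → ℝ) : Prop :=
  ∀ A A' : Finset (Fin K), A.Nonempty →
    c A A' ∈ simplexOn A ∧ IsMaxOn (coverage sd A') (simplexOn A) (c A A')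

/-- `m(A, A')`, the value of the maximin problem. -/
def maximinValue {K : ℕ} (sd : Fin K → Fin K → ℝ≥0∞)
    (c : Finset (Fin K) → Finset (Fin K) → Fin K → ℝ) (A A' : Finset (Fin K)) : ℝ :=
  coverage sd A' (c A A')

/-- `A^S`: the members of `A` that are observed by some member of `A`. -/
def strongPart {K : ℕ} (sd : Fin K → Fin K → ℝ≥0∞) (A : Finset (Fin K)) : Finset (Fin K) :=
  open Classical in A.filter fun i => ∃ j ∈ A, i ∈ obsSet sd j

/-- `A^W = A \ A^S`. -/
def weakPart {K : ℕ} (sd : Fin K → Fin K → ℝ≥0∞) (A : Finset (Fin K)) : Finset (Fin K) :=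
  A \ strongPart sd A

/-! ### The successive elimination algorithm

`h : List (Fin K)` lists the actions played so far: `h[t]` is the action of round `t`.
`x t i j` is a realization of the observations. -/

/-- The number of observations of action `i` along the history `h`. -/
def numObs {K : ℕ} (sd : Fin K → Fin K → ℝ≥0∞) (h : List (Fin K)) (i : Fin K) : ℕ :=
  (Finset.univ.filter fun t : Fin h.length => i ∈ obsSet sd (h.get t)).card

/-- The empirical mean of the observations of action `i` along the history `h`. -/
def empMean {K : ℕ} (sd : Fin K → Fin K → ℝ≥0∞) (x : ℕ → Fin K → Fin K → ℝ)
    (h : List (Fin K)) (i : Fin K) : ℝ :=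
  (∑ t ∈ Finset.univ.filter (fun t : Fin h.length => i ∈ obsSet sd (h.get t)),
    x t (h.get t) i) / numObs sd h i

/-- The confidence radius `g_{i,r}(δ) = σ √(2 log(8 K² r³ / δ) / n_i(r))`. It is only used after
the first phase, in which every action is observed at least once. -/
def confRadius {K : ℕ} (sd : Fin K → Fin K → ℝ≥0∞) (σ δ : ℝ) (h : List (Fin K)) (r : ℕ)
    (i : Fin K) : ℝ :=
  σ * Real.sqrt (2 * Real.log (8 * (K : ℝ) ^ 2 * (r : ℝ) ^ 3 / δ) / numObs sd h i)

/-- The state at the beginning of a phase `r`: the actions played in the previous phases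
(so `t_r` is the length of this list), the set `A_r`, and the collection `{A_1, …, A_r}`. -/
structure State (K : ℕ) where
  played : List (Fin K)
  active : Finset (Fin K)
  visited : Finset (Finset (Fin K))

/-- `α_r`: the minimum of `m([K], A_s^W)` over the `s ≤ r` with `A_s^W ≠ ∅`, and `1` if there is
no such `s`. -/
def alpha {K : ℕ} (sd : Fin K → Fin K → ℝ≥0∞)
    (c : Finset (Fin K) → Finset (Fin K) → Fin K → ℝ) (s : State K) : ℝ :=
  open Classical in
  if h : (s.visited.filter fun A => (weakPart sd A).Nonempty).Nonempty then
    (s.visited.filter fun A => (weakPart sd A).Nonempty).inf' h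
      (fun A => maximinValue sd c Finset.univ (weakPart sd A))
  else 1

/-- `γ(r) = (σ α_r t_r / D)^{2/3}`. -/
def gammaThreshold {K : ℕ} (sd : Fin K → Fin K → ℝ≥0∞)
    (c : Finset (Fin K) → Finset (Fin K) → Fin K → ℝ) (σ D : ℝ) (s : State K) : ℝ :=
  (σ * alpha sd c s * (s.played.length : ℝ) / D) ^ ((2 : ℝ) / 3)

/-- The condition for exploring with all actions: `A_r^W ≠ ∅`,
`min_{A_r^W} n_i(r) < min_{A_r^S} n_i(r)` (with `min ∅ = ∞`) and `min_{A_r^W} n_i(r) < γ(r)`. -/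
def ExploreWeak {K : ℕ} (sd : Fin K → Fin K → ℝ≥0∞)
    (c : Finset (Fin K) → Finset (Fin K) → Fin K → ℝ) (σ D : ℝ) (s : State K) : Prop :=
  (weakPart sd s.active).Nonempty ∧
  (weakPart sd s.active).inf (fun i => (numObs sd s.played i : ℕ∞)) <
    (strongPart sd s.active).inf (fun i => (numObs sd s.played i : ℕ∞)) ∧
  ∃ i ∈ weakPart sd s.active, (numObs sd s.played i : ℝ) < gammaThreshold sd c σ D s

/-- The exploration vector `c_r`. -/
def phaseVector {K : ℕ} (sd : Fin K → Fin K → ℝ≥0∞)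
    (c : Finset (Fin K) → Finset (Fin K) → Fin K → ℝ) (σ D : ℝ) (s : State K) : Fin K → ℝ :=
  open Classical in
  if ExploreWeak sd c σ D s then c Finset.univ (weakPart sd s.active)
  else c s.active (strongPart sd s.active)

/-- `⌈c · ‖c‖₀⌉`: how often each action is played in a phase. -/
def playCounts {K : ℕ} (c : Fin K → ℝ) (j : Fin K) : ℕ :=
  ⌈c j * ((Finset.univ.filter fun k => c k ≠ 0).card : ℝ)⌉₊

/-- `ord r v` is the order in which the plays of phase `r` are made, if each action `a` has to be
played `v a` times. -/
def IsPlayOrder {K : ℕ} (ord : ℕ → (Fin K → ℕ) → List (Fin K)) : Prop :=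
  ∀ r v a, (ord r v).count a = v a

/-- The actions of `A` that survive the elimination step that ends phase `r - 1`, where `h` is the
history up to that point. -/
def survivors {K : ℕ} (sd : Fin K → Fin K → ℝ≥0∞) (σ δ : ℝ) (x : ℕ → Fin K → Fin K → ℝ)
    (h : List (Fin K)) (r : ℕ) (A : Finset (Fin K)) : Finset (Fin K) :=
  open Classical in
  A.filter fun i => ∀ j ∈ A,
    empMean sd x h j - confRadius sd σ δ h r j ≤ empMean sd x h i + confRadius sd σ δ h r i

/-- Phase `r`. If only one action is left, then it is played (once in each of the infinitely many
remaining phases, hence in all remaining rounds). -/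
def phaseStep {K : ℕ} (sd : Fin K → Fin K → ℝ≥0∞)
    (c : Finset (Fin K) → Finset (Fin K) → Fin K → ℝ) (ord : ℕ → (Fin K → ℕ) → List (Fin K))
    (σ D δ : ℝ) (x : ℕ → Fin K → Fin K → ℝ) (r : ℕ) (s : State K) : State K :=
  if s.active.card = 1 then
    { played := s.played ++ s.active.toList, active := s.active, visited := s.visited }
  else
    let h := s.played ++ ord r (playCounts (phaseVector sd c σ D s))
    let A := survivors sd σ δ x h (r + 1) s.active
    { played := h, active := A, visited := insert A s.visited }

/-- The state after `n` phases, that is, at the beginning of phase `n + 1`. -/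
def run {K : ℕ} (sd : Fin K → Fin K → ℝ≥0∞)
    (c : Finset (Fin K) → Finset (Fin K) → Fin K → ℝ) (ord : ℕ → (Fin K → ℕ) → List (Fin K))
    (σ D δ : ℝ) (x : ℕ → Fin K → Fin K → ℝ) : ℕ → State K
  | 0 => { played := [], active := Finset.univ, visited := {Finset.univ} }
  | n + 1 => phaseStep sd c ord σ D δ x (n + 1) (run sd c ord σ D δ x n)

/-- The actions of the first `T` rounds. Each phase makes at least one play, so `T` phases
suffice; the last phase that is reached is cut off at round `T`. -/
def actions {K : ℕ} (sd : Fin K → Fin K → ℝ≥0∞)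
    (c : Finset (Fin K) → Finset (Fin K) → Fin K → ℝ) (ord : ℕ → (Fin K → ℕ) → List (Fin K))
    (σ D δ : ℝ) (x : ℕ → Fin K → Fin K → ℝ) (T : ℕ) : List (Fin K) :=
  (run sd c ord σ D δ x T).played.take T

/-- The gap `d_i(θ) = max_j θ_j - θ_i`. -/
def gap {K : ℕ} (θ : Fin K → ℝ) (i : Fin K) : ℝ := (⨆ j, θ j) - θ i

/-- The regret without expectation, `∑_i N_i(T) d_i(θ)`, of the algorithm. -/
def regret {K : ℕ} (sd : Fin K → Fin K → ℝ≥0∞)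
    (c : Finset (Fin K) → Finset (Fin K) → Fin K → ℝ) (ord : ℕ → (Fin K → ℕ) → List (Fin K))
    (σ D δ : ℝ) (x : ℕ → Fin K → Fin K → ℝ) (θ : Fin K → ℝ) (T : ℕ) : ℝ :=
  ∑ i, ((actions sd c ord σ D δ x T).count i : ℝ) * gap θ i

end

end SideObs

namespace SideObs

/-! ### Plays and observations along a list of actions -/

/-! The proof separates chance from counting. All chance is in `GoodEvent`: every empirical mean at
the end of a phase lies within its confidence radius. On that event the regret bounds are
deterministic.

Concentration. The number of observations of an action is random, so fix a value `k` and keep only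
the first `k` observations of `i`. Which action supplies the observation of round `t` is determined
by the earlier rounds, so the product of the factors `exp (l (X - θ_i) - l² σ² / 2)` over the
observing rounds has mean one (`lintegral_prod_predictable`). Markov's inequality and a union bound
over `k`, the phases and the actions give `measure_not_goodEvent_le`.

Elimination. On the good event a best action is never eliminated. An action that is still active
after the first phase has a gap of at most four confidence radii, hence of order `σ √(L / M)` if
every active action has been observed `M` times, with `L = log (2KT/δ)` (`gap_le_of_active`).

Counting. A phase with vector `c` lasts at most `2‖c‖₀` rounds and observes each target at least
`‖c‖₀ m` times, where `m` is the maximin value; so time and observations are proportional up to the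
factor `2 / m`. The uniform vector on a dominating set shows that `m` is at least the inverse of its
size. In the strong case a greedy argument yields dominating sets of size of order `κ log K`, so `M`
grows like `τ / (κ log K)`, and the gap bounds sum to the `√T` rate.

In the weak case, phases exploring with all actions cost up to `D` per round. They stop once the
weak part has been observed `γ` times, so their total length is of order `ρ^{1/3} (σT/D)^{2/3}`,
plus `O(K²)` for changes of the weak part (`weakRounds_le_numObs`, `weakRounds_succ_le`). In any
other late phase all active actions have been observed at least `(στ/(ρD))^{2/3}` times
(`le_numObs_of_not_exploreWeak`), so gaps are of order `τ^{-1/3}` and sum to the `T^{2/3}` rate.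
`exists_regret_le` combines the two costs. -/

theorem sum_count_mul_eq_sum_map {K : ℕ} {M : Type*} [CommSemiring M] (l : List (Fin K))
    (f : Fin K → M) : ∑ a, (l.count a : M) * f a = (l.map f).sum := by
  induction l with
  | nil => simp
  | cons b l ih =>
    simp only [List.count_cons, List.map_cons, List.sum_cons, ← ih, Nat.cast_add, add_mul,
      Finset.sum_add_distrib]
    rw [add_comm]
    congr 1
    simp

theorem sum_count_eq_length {K : ℕ} (l : List (Fin K)) : ∑ a, l.count a = l.length := by
  have := sum_count_mul_eq_sum_map l (fun _ => (1 : ℕ))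
  simpa using this

theorem numObs_eq_sum_map {K : ℕ} (sd : Fin K → Fin K → ℝ≥0∞) (h : List (Fin K)) (i : Fin K) :
    numObs sd h i = (h.map fun a => if i ∈ obsSet sd a then 1 else 0).sum := by
  rw [numObs, Finset.card_filter]
  simp only [List.get_eq_getElem]
  exact Fin.sum_univ_fun_getElem h (fun a => if i ∈ obsSet sd a then 1 else 0)

theorem numObs_append {K : ℕ} (sd : Fin K → Fin K → ℝ≥0∞) (h l : List (Fin K)) (i : Fin K) :
    numObs sd (h ++ l) i = numObs sd h i + numObs sd l i := by
  simp [numObs_eq_sum_map]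

theorem numObs_le_length {K : ℕ} (sd : Fin K → Fin K → ℝ≥0∞) (h : List (Fin K)) (i : Fin K) :
    numObs sd h i ≤ h.length := by
  rw [numObs]
  exact (Finset.card_le_univ _).trans (by simp)

theorem numObs_eq_sum_count {K : ℕ} (sd : Fin K → Fin K → ℝ≥0∞) (h : List (Fin K)) (i : Fin K) :
    numObs sd h i = ∑ a ∈ Finset.univ.filter (fun a => i ∈ obsSet sd a), h.count a := by
  rw [numObs_eq_sum_map, ← sum_count_mul_eq_sum_map, Finset.sum_filter]
  exact Finset.sum_congr rfl fun a _ => by simp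

/-! ### The number of plays in a phase -/

/-- `‖c‖₀`. -/
noncomputable def suppCard {K : ℕ} (c : Fin K → ℝ) : ℕ :=
  (Finset.univ.filter fun k => c k ≠ 0).card

theorem suppCard_le {K : ℕ} (c : Fin K → ℝ) : suppCard c ≤ K :=
  (Finset.card_le_univ _).trans (by simp)

theorem playCounts_eq {K : ℕ} (c : Fin K → ℝ) (j : Fin K) :
    playCounts c j = ⌈c j * (suppCard c : ℝ)⌉₊ := rfl

theorem playCounts_eq_zero {K : ℕ} {A : Finset (Fin K)} {c : Fin K → ℝ} (hc : c ∈ simplexOn A)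
    {j : Fin K} (hj : j ∉ A) : playCounts c j = 0 := by
  simp [playCounts_eq, hc.2.1 j hj]

theorem suppCard_pos {K : ℕ} {A : Finset (Fin K)} {c : Fin K → ℝ} (hc : c ∈ simplexOn A) :
    0 < suppCard c := by
  by_contra h
  have h0 : (Finset.univ.filter fun k => c k ≠ 0) = ∅ :=
    Finset.card_eq_zero.1 (Nat.eq_zero_of_not_pos h)
  have h1 : ∀ k, c k = 0 := fun k => by
    by_contra hk
    have : k ∈ (Finset.univ.filter fun k => c k ≠ 0) := by simp [hk]
    simp [h0] at this
  have := hc.2.2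
  simp [h1] at this

/-- The unrounded counts sum to `‖c‖₀`, and rounding up adds at most one for each coordinate of the
support. -/
theorem sum_playCounts_le {K : ℕ} {A : Finset (Fin K)} {c : Fin K → ℝ} (hc : c ∈ simplexOn A) :
    ∑ j, playCounts c j ≤ 2 * suppCard c := by
  have h : ∀ j, (playCounts c j : ℝ) ≤ c j * suppCard c + if c j ≠ 0 then 1 else 0 := by
    intro j
    rw [playCounts_eq]
    split_ifs with h0
    · exact (Nat.ceil_lt_add_one (mul_nonneg (hc.1 j) (Nat.cast_nonneg _))).le
    · simp [not_not.1 h0]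
  have h2 : ((∑ j, playCounts c j : ℕ) : ℝ) ≤ 2 * suppCard c := by
    push_cast
    refine (Finset.sum_le_sum fun j _ => h j).trans ?_
    rw [Finset.sum_add_distrib, ← Finset.sum_mul, hc.2.2, ← Finset.sum_filter]
    simp only [Finset.sum_const, nsmul_eq_mul, mul_one, one_mul]
    rw [show ((Finset.univ.filter fun k => c k ≠ 0).card : ℝ) = (suppCard c : ℝ) from rfl]
    linarith
  exact_mod_cast h2

/-- Rounding up only adds observations. Against `sum_playCounts_le` the factor `‖c‖₀` cancels, so
the exchange rate between rounds and observations depends on the maximin value alone. -/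
theorem le_sum_playCounts {K : ℕ} {A' : Finset (Fin K)} (sd : Fin K → Fin K → ℝ≥0∞)
    (c : Fin K → ℝ) {i : Fin K} (hi : i ∈ A') :
    (suppCard c : ℝ) * coverage sd A' c ≤
      ((∑ a ∈ Finset.univ.filter (fun a => i ∈ obsSet sd a), playCounts c a : ℕ) : ℝ) := by
  have hne : A'.Nonempty := ⟨i, hi⟩
  have h1 : coverage sd A' c ≤ ∑ j ∈ Finset.univ.filter (fun j => i ∈ obsSet sd j), c j := by
    rw [coverage, dif_pos hne]
    exact Finset.inf'_le (fun i => ∑ j ∈ Finset.univ.filter (fun j => i ∈ obsSet sd j), c j) hi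
  refine (mul_le_mul_of_nonneg_left h1 (Nat.cast_nonneg _)).trans ?_
  push_cast
  rw [Finset.mul_sum]
  refine Finset.sum_le_sum fun j _ => ?_
  rw [playCounts_eq, mul_comm]
  exact Nat.le_ceil _

/-! ### Lower bounds on the maximin value -/

/-- The uniform distribution on `B` is a competitor in the maximin problem, and each target is
observed by at least one atom of it. -/
theorem inv_card_le_maximinValue {K : ℕ} {sd : Fin K → Fin K → ℝ≥0∞}
    {c : Finset (Fin K) → Finset (Fin K) → Fin K → ℝ} (hc : IsMaximinRule sd c)
    {A A' B : Finset (Fin K)} (hA' : A'.Nonempty) (hB : B ⊆ A) (hdom : Dominates sd B A') :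
    (1 : ℝ) / B.card ≤ maximinValue sd c A A' := by
  classical
  have hBne : B.Nonempty := by
    obtain ⟨j, hj⟩ := hA'
    obtain ⟨i, hi, -⟩ := hdom j hj
    exact ⟨i, hi⟩
  have hBpos : (0 : ℝ) < B.card := by exact_mod_cast hBne.card_pos
  let u : Fin K → ℝ := fun j => if j ∈ B then 1 / (B.card : ℝ) else 0
  have hu : u ∈ simplexOn A := by
    refine ⟨fun j => ?_, fun j hj => ?_, ?_⟩
    · dsimp only [u]; split_ifs <;> positivity
    · exact if_neg fun h => hj (hB h)
    · simp only [u, Finset.sum_ite_mem, Finset.univ_inter, Finset.sum_const, nsmul_eq_mul]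
      field_simp
  refine le_trans ?_ ((hc A A' (hBne.mono hB)).2 hu)
  rw [coverage, dif_pos hA']
  refine Finset.le_inf' _ _ fun i hi => ?_
  obtain ⟨b, hb, hbi⟩ := hdom i hi
  have : u b = 1 / (B.card : ℝ) := if_pos hb
  rw [← this]
  exact Finset.single_le_sum (f := u) (fun j _ => hu.1 j) (by simpa using hbi)

theorem strongPart_subset {K : ℕ} (sd : Fin K → Fin K → ℝ≥0∞) (A : Finset (Fin K)) :
    strongPart sd A ⊆ A := Finset.filter_subset _ _

theorem weakPart_subset {K : ℕ} (sd : Fin K → Fin K → ℝ≥0∞) (A : Finset (Fin K)) :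
    weakPart sd A ⊆ A := Finset.sdiff_subset

theorem mem_strongPart {K : ℕ} {sd : Fin K → Fin K → ℝ≥0∞} {A : Finset (Fin K)} {i : Fin K} :
    i ∈ strongPart sd A ↔ i ∈ A ∧ ∃ j ∈ A, i ∈ obsSet sd j := by
  simp [strongPart]

theorem mem_weakPart {K : ℕ} {sd : Fin K → Fin K → ℝ≥0∞} {A : Finset (Fin K)} {i : Fin K} :
    i ∈ weakPart sd A ↔ i ∈ A ∧ i ∉ strongPart sd A := by
  simp [weakPart]

theorem strongPart_of_subset {K : ℕ} {sd : Fin K → Fin K → ℝ≥0∞} {A B : Finset (Fin K)}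
    (h : A ⊆ B) {i : Fin K} (hi : i ∈ strongPart sd A) : i ∈ strongPart sd B := by
  rw [mem_strongPart] at hi ⊢
  obtain ⟨h1, j, hj, h2⟩ := hi
  exact ⟨h h1, j, h hj, h2⟩

theorem dominates_strongPart {K : ℕ} (sd : Fin K → Fin K → ℝ≥0∞) (A : Finset (Fin K)) :
    Dominates sd A (strongPart sd A) := fun _ hj => (mem_strongPart.1 hj).2

theorem strongPart_univ {K : ℕ} {sd : Fin K → Fin K → ℝ≥0∞} (hcov : ∀ j, ∃ i, j ∈ obsSet sd i) :
    strongPart sd Finset.univ = Finset.univ := by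
  ext i
  simp [mem_strongPart, hcov i]

/-- A strongly observable action is observed by itself or by any other action. Two members in `A`
are enough for one of these observers to lie in `A`. -/
theorem weakPart_subset_weakSet {K : ℕ} {sd : Fin K → Fin K → ℝ≥0∞}
    (hcov : ∀ j, ∃ i, j ∈ obsSet sd i) {A : Finset (Fin K)} (hA : 1 < A.card) :
    weakPart sd A ⊆ weakSet sd := by
  intro i hi
  obtain ⟨hiA, hiS⟩ := mem_weakPart.1 hi
  simp only [weakSet, Finset.mem_filter, Finset.mem_univ, true_and]
  refine ⟨fun hs => hiS ?_, hcov i⟩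
  rw [mem_strongPart]
  rcases hs with hs | hs
  · exact ⟨hiA, i, hiA, hs⟩
  · obtain ⟨j, hj, hji⟩ := Finset.exists_mem_ne hA i
    exact ⟨hiA, j, hj, hs j hji⟩

theorem exists_dominates_weakSet {K : ℕ} {sd : Fin K → Fin K → ℝ≥0∞}
    (hcov : ∀ j, ∃ i, j ∈ obsSet sd i) :
    ∃ B : Finset (Fin K), Dominates sd B (weakSet sd) ∧ B.card = weakDominationNumber sd := by
  have hne : {n | ∃ A : Finset (Fin K), Dominates sd A (weakSet sd) ∧ A.card = n}.Nonempty :=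
    ⟨_, Finset.univ, fun j _ => by simpa using hcov j, rfl⟩
  exact Nat.sInf_mem hne

theorem weakDominationNumber_le {K : ℕ} {sd : Fin K → Fin K → ℝ≥0∞}
    (hcov : ∀ j, ∃ i, j ∈ obsSet sd i) : weakDominationNumber sd ≤ K := by
  obtain ⟨B, -, hB⟩ := exists_dominates_weakSet hcov
  rw [← hB]
  exact (Finset.card_le_univ _).trans (by simp)

theorem weakDominationNumber_pos {K : ℕ} {sd : Fin K → Fin K → ℝ≥0∞}
    (hcov : ∀ j, ∃ i, j ∈ obsSet sd i) (hw : WeaklyObservable sd) :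
    0 < weakDominationNumber sd := by
  obtain ⟨B, hB, hBc⟩ := exists_dominates_weakSet hcov
  obtain ⟨j, hj⟩ := Finset.nonempty_iff_ne_empty.2 hw
  obtain ⟨i, hi, -⟩ := hB j hj
  rw [← hBc]
  exact Finset.card_pos.2 ⟨i, hi⟩

theorem inv_weakDominationNumber_le {K : ℕ} {sd : Fin K → Fin K → ℝ≥0∞}
    {c : Finset (Fin K) → Finset (Fin K) → Fin K → ℝ} (hc : IsMaximinRule sd c)
    (hcov : ∀ j, ∃ i, j ∈ obsSet sd i) {A : Finset (Fin K)} (hA : 1 < A.card)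
    (hne : (weakPart sd A).Nonempty) :
    (1 : ℝ) / weakDominationNumber sd ≤ maximinValue sd c Finset.univ (weakPart sd A) := by
  obtain ⟨B, hB, hBc⟩ := exists_dominates_weakSet hcov
  rw [← hBc]
  exact inv_card_le_maximinValue hc hne (Finset.subset_univ _)
    fun j hj => hB j (weakPart_subset_weakSet hcov hA hj)

theorem inv_le_maximinValue_strongPart {K : ℕ} {sd : Fin K → Fin K → ℝ≥0∞}
    {c : Finset (Fin K) → Finset (Fin K) → Fin K → ℝ} (hc : IsMaximinRule sd c)
    {A : Finset (Fin K)} (hne : (strongPart sd A).Nonempty) :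
    (1 : ℝ) / K ≤ maximinValue sd c A (strongPart sd A) := by
  refine le_trans ?_ (inv_card_le_maximinValue hc hne subset_rfl (dominates_strongPart sd A))
  have h1 : 0 < A.card := Finset.card_pos.2 (hne.mono (strongPart_subset sd A))
  have h2 : A.card ≤ K := (Finset.card_le_univ _).trans (by simp)
  gcongr

/-- A weakly observable structure has at least three actions. -/
theorem three_le_of_weaklyObservable {K : ℕ} {sd : Fin K → Fin K → ℝ≥0∞}
    (hw : WeaklyObservable sd) : 3 ≤ K := by
  obtain ⟨i, hi⟩ := Finset.nonempty_iff_ne_empty.2 hw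
  simp only [weakSet, Finset.mem_filter, Finset.mem_univ, true_and] at hi
  obtain ⟨hs, j, hj⟩ := hi
  simp only [StronglyObservableAction, not_or, not_forall] at hs
  obtain ⟨h1, l, hl, h2⟩ := hs
  have hji : j ≠ i := fun h => h1 (h ▸ hj)
  have hjl : j ≠ l := fun h => h2 (h ▸ hj)
  have := Finset.card_le_univ ({i, j, l} : Finset (Fin K))
  rw [Finset.card_eq_three.2 ⟨i, j, l, hji.symm, hl.symm, hjl, rfl⟩] at this
  simpa using this

/-! ### The phases of the algorithm -/

section Phases

variable {K : ℕ} {sd : Fin K → Fin K → ℝ≥0∞}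
  {c : Finset (Fin K) → Finset (Fin K) → Fin K → ℝ} {ord : ℕ → (Fin K → ℕ) → List (Fin K)}
  {σ D δ : ℝ} {x : ℕ → Fin K → Fin K → ℝ}

/-- The plays of phase `r` when it starts in state `s`. -/
noncomputable def phaseList (sd : Fin K → Fin K → ℝ≥0∞)
    (c : Finset (Fin K) → Finset (Fin K) → Fin K → ℝ) (ord : ℕ → (Fin K → ℕ) → List (Fin K))
    (σ D : ℝ) (r : ℕ) (s : State K) : List (Fin K) :=
  if s.active.card = 1 then s.active.toList else ord r (playCounts (phaseVector sd c σ D s))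

theorem phaseStep_played (r : ℕ) (s : State K) :
    (phaseStep sd c ord σ D δ x r s).played = s.played ++ phaseList sd c ord σ D r s := by
  unfold phaseStep phaseList
  split_ifs <;> rfl

theorem phaseStep_active_of_card_ne_one {r : ℕ} {s : State K} (h : s.active.card ≠ 1) :
    (phaseStep sd c ord σ D δ x r s).active =
      survivors sd σ δ x (s.played ++ phaseList sd c ord σ D r s) (r + 1) s.active := by
  simp only [phaseStep, phaseList, if_neg h]

theorem phaseStep_of_card_eq_one {r : ℕ} {s : State K} (h : s.active.card = 1) :
    (phaseStep sd c ord σ D δ x r s).active = s.active := by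
  simp only [phaseStep, if_pos h]

theorem run_succ (n : ℕ) : run sd c ord σ D δ x (n + 1) =
    phaseStep sd c ord σ D δ x (n + 1) (run sd c ord σ D δ x n) := rfl

theorem run_succ_played (n : ℕ) : (run sd c ord σ D δ x (n + 1)).played =
    (run sd c ord σ D δ x n).played ++ phaseList sd c ord σ D (n + 1) (run sd c ord σ D δ x n) :=
  phaseStep_played _ _

theorem run_succ_active {n : ℕ} (h : (run sd c ord σ D δ x n).active.card ≠ 1) :
    (run sd c ord σ D δ x (n + 1)).active =
      survivors sd σ δ x (run sd c ord σ D δ x (n + 1)).played (n + 1 + 1)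
        (run sd c ord σ D δ x n).active := by
  rw [run_succ_played, run_succ, phaseStep_active_of_card_ne_one h]

theorem survivors_subset (h : List (Fin K)) (r : ℕ) (A : Finset (Fin K)) :
    survivors sd σ δ x h r A ⊆ A := Finset.filter_subset _ _

theorem mem_survivors {h : List (Fin K)} {r : ℕ} {A : Finset (Fin K)} {i : Fin K} :
    i ∈ survivors sd σ δ x h r A ↔ i ∈ A ∧ ∀ j ∈ A,
      empMean sd x h j - confRadius sd σ δ h r j ≤ empMean sd x h i + confRadius sd σ δ h r i := by
  simp [survivors]

theorem confRadius_nonneg (hσ : 0 ≤ σ) (h : List (Fin K)) (r : ℕ) (i : Fin K) :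
    0 ≤ confRadius sd σ δ h r i := mul_nonneg hσ (Real.sqrt_nonneg _)

/-- The action with the largest lower confidence bound always survives. -/
theorem survivors_nonempty (hσ : 0 ≤ σ) (h : List (Fin K)) (r : ℕ) {A : Finset (Fin K)}
    (hA : A.Nonempty) : (survivors sd σ δ x h r A).Nonempty := by
  obtain ⟨i, hi, hmax⟩ := Finset.exists_max_image A
    (fun j => empMean sd x h j - confRadius sd σ δ h r j) hA
  refine ⟨i, mem_survivors.2 ⟨hi, fun j hj => (hmax j hj).trans ?_⟩⟩
  have := confRadius_nonneg (sd := sd) (δ := δ) hσ h r i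
  linarith

theorem run_succ_active_subset (n : ℕ) :
    (run sd c ord σ D δ x (n + 1)).active ⊆ (run sd c ord σ D δ x n).active := by
  by_cases h : (run sd c ord σ D δ x n).active.card = 1
  · rw [run_succ, phaseStep_of_card_eq_one h]
  · rw [run_succ_active h]
    exact survivors_subset _ _ _

theorem run_active_nonempty (hK : 0 < K) (hσ : 0 ≤ σ) (n : ℕ) :
    (run sd c ord σ D δ x n).active.Nonempty := by
  induction n with
  | zero => exact ⟨⟨0, hK⟩, Finset.mem_univ _⟩
  | succ n ih =>
    by_cases h : (run sd c ord σ D δ x n).active.card = 1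
    · rw [run_succ, phaseStep_of_card_eq_one h]
      exact ih
    · rw [run_succ_active h]
      exact survivors_nonempty hσ _ _ ih

theorem run_card_ne_one_of_succ {n : ℕ} (h : (run sd c ord σ D δ x (n + 1)).active.card ≠ 1) :
    (run sd c ord σ D δ x n).active.card ≠ 1 := fun h1 => by
  rw [run_succ, phaseStep_of_card_eq_one h1] at h
  exact h h1

/-- Since all visited sets contain the current active set, they have at least two members as long as
the algorithm still explores. This makes the bound by the weak domination number available for every
set that enters `alpha`. -/
theorem run_visited (n : ℕ) :
    (run sd c ord σ D δ x n).active ∈ (run sd c ord σ D δ x n).visited ∧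
      (∀ B ∈ (run sd c ord σ D δ x n).visited, (run sd c ord σ D δ x n).active ⊆ B) ∧
      (run sd c ord σ D δ x n).visited ⊆ (run sd c ord σ D δ x (n + 1)).visited := by
  have hsub : ∀ n, (run sd c ord σ D δ x n).visited ⊆ (run sd c ord σ D δ x (n + 1)).visited := by
    intro n
    rw [run_succ, phaseStep]
    split_ifs
    · exact subset_rfl
    · exact Finset.subset_insert _ _
  refine ⟨?_, ?_, hsub n⟩
  · induction n with
    | zero => simp [run]
    | succ n ih =>
      rw [run_succ, phaseStep]
      split_ifs
      · exact ih
      · simp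
  · induction n with
    | zero => simp [run]
    | succ n ih =>
      rw [run_succ, phaseStep]
      split_ifs
      · exact ih
      · intro B hB
        rcases Finset.mem_insert.1 hB with rfl | hB
        · exact subset_rfl
        · exact (survivors_subset _ _ _).trans (ih B hB)

theorem phaseVector_mem (hc : IsMaximinRule sd c) {s : State K} (hs : s.active.Nonempty) :
    phaseVector sd c σ D s ∈ simplexOn Finset.univ ∧
      (¬ ExploreWeak sd c σ D s → phaseVector sd c σ D s ∈ simplexOn s.active) := by
  have h2 := (hc s.active (strongPart sd s.active) hs).1
  constructor
  · rw [phaseVector]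
    split_ifs
    · exact (hc _ _ (hs.mono (Finset.subset_univ _))).1
    · exact ⟨h2.1, fun j hj => absurd (Finset.mem_univ j) hj, h2.2.2⟩
  · intro h
    rw [phaseVector, if_neg h]
    exact h2

theorem length_phaseList (hord : IsPlayOrder ord) {r : ℕ} {s : State K} (h : s.active.card ≠ 1) :
    (phaseList sd c ord σ D r s).length = ∑ j, playCounts (phaseVector sd c σ D s) j := by
  rw [phaseList, if_neg h, ← sum_count_eq_length]
  exact Finset.sum_congr rfl fun j _ => hord _ _ _

theorem numObs_phaseList (hord : IsPlayOrder ord) {r : ℕ} {s : State K} (h : s.active.card ≠ 1)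
    (i : Fin K) : numObs sd (phaseList sd c ord σ D r s) i =
      ∑ a ∈ Finset.univ.filter (fun a => i ∈ obsSet sd a),
        playCounts (phaseVector sd c σ D s) a := by
  rw [phaseList, if_neg h, numObs_eq_sum_count]
  exact Finset.sum_congr rfl fun j _ => hord _ _ _

theorem length_phaseList_le (hc : IsMaximinRule sd c) (hord : IsPlayOrder ord) {r : ℕ}
    {s : State K} (hs : s.active.Nonempty) (h : s.active.card ≠ 1) :
    (phaseList sd c ord σ D r s).length ≤ 2 * suppCard (phaseVector sd c σ D s) := by
  rw [length_phaseList hord h]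
  exact sum_playCounts_le (phaseVector_mem hc hs).1

theorem length_phaseList_le' (hK : 0 < K) (hc : IsMaximinRule sd c) (hord : IsPlayOrder ord)
    {r : ℕ} {s : State K} (hs : s.active.Nonempty) :
    (phaseList sd c ord σ D r s).length ≤ 2 * K := by
  by_cases h : s.active.card = 1
  · rw [phaseList, if_pos h, Finset.length_toList, h]
    omega
  · exact (length_phaseList_le hc hord hs h).trans (by have := suppCard_le (phaseVector sd c σ D s); omega)

theorem length_phaseList_pos (hc : IsMaximinRule sd c) (hord : IsPlayOrder ord) {r : ℕ}
    {s : State K} (hs : s.active.Nonempty) : 0 < (phaseList sd c ord σ D r s).length := by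
  by_cases h : s.active.card = 1
  · rw [phaseList, if_pos h, Finset.length_toList, h]
    omega
  · rw [length_phaseList hord h]
    have hm := (phaseVector_mem (σ := σ) (D := D) hc hs).1
    have hpos := suppCard_pos hm
    obtain ⟨j, hj⟩ := Finset.card_pos.1 hpos
    have hj' : phaseVector sd c σ D s j ≠ 0 := by simpa using hj
    have : 0 < playCounts (phaseVector sd c σ D s) j := by
      rw [playCounts_eq, Nat.ceil_pos]
      have := (hm.1 j).lt_of_ne' hj'
      have : (0 : ℝ) < suppCard (phaseVector sd c σ D s) := by exact_mod_cast hpos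
      positivity
    exact this.trans_le (Finset.single_le_sum (f := playCounts (phaseVector sd c σ D s))
      (fun _ _ => Nat.zero_le _) (Finset.mem_univ j))

theorem le_length_run (hK : 0 < K) (hσ : 0 ≤ σ) (hc : IsMaximinRule sd c) (hord : IsPlayOrder ord)
    (n : ℕ) : n ≤ (run sd c ord σ D δ x n).played.length := by
  induction n with
  | zero => simp
  | succ n ih =>
    rw [run_succ_played, List.length_append]
    have := length_phaseList_pos (σ := σ) (D := D) (r := n + 1) hc hord
      (run_active_nonempty (sd := sd) (c := c) (ord := ord) (D := D) (δ := δ) (x := x) hK hσ n)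
    omega

theorem length_run_le (hK : 0 < K) (hσ : 0 ≤ σ) (hc : IsMaximinRule sd c) (hord : IsPlayOrder ord)
    (n : ℕ) : (run sd c ord σ D δ x n).played.length ≤ 2 * K * n := by
  induction n with
  | zero => simp [run]
  | succ n ih =>
    rw [run_succ_played, List.length_append]
    have := length_phaseList_le' (σ := σ) (D := D) (r := n + 1) hK hc hord
      (run_active_nonempty (sd := sd) (c := c) (ord := ord) (D := D) (δ := δ) (x := x) hK hσ n)
    rw [mul_add, mul_one]
    omega

theorem numObs_run_succ (n : ℕ) (i : Fin K) :
    numObs sd (run sd c ord σ D δ x n).played i ≤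
      numObs sd (run sd c ord σ D δ x (n + 1)).played i := by
  rw [run_succ_played, numObs_append]
  omega

/-- In a phase that explores with the active set, every member of the strong part is observed at
least `‖c‖₀ m(A, A^S)` times. -/
theorem numObs_run_succ_strong (hord : IsPlayOrder ord) {n : ℕ}
    (h1 : (run sd c ord σ D δ x n).active.card ≠ 1)
    (hE : ¬ ExploreWeak sd c σ D (run sd c ord σ D δ x n)) {i : Fin K}
    (hi : i ∈ strongPart sd (run sd c ord σ D δ x n).active) :
    (numObs sd (run sd c ord σ D δ x n).played i : ℝ) +
        suppCard (phaseVector sd c σ D (run sd c ord σ D δ x n)) *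
          maximinValue sd c (run sd c ord σ D δ x n).active
            (strongPart sd (run sd c ord σ D δ x n).active) ≤
      numObs sd (run sd c ord σ D δ x (n + 1)).played i := by
  rw [run_succ_played, numObs_append, numObs_phaseList hord h1, Nat.cast_add]
  refine add_le_add le_rfl (le_trans ?_ (le_sum_playCounts sd _ hi))
  rw [phaseVector, if_neg hE, maximinValue]

theorem numObs_run_succ_weak (hord : IsPlayOrder ord) {n : ℕ}
    (h1 : (run sd c ord σ D δ x n).active.card ≠ 1)
    (hE : ExploreWeak sd c σ D (run sd c ord σ D δ x n)) {i : Fin K}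
    (hi : i ∈ weakPart sd (run sd c ord σ D δ x n).active) :
    (numObs sd (run sd c ord σ D δ x n).played i : ℝ) +
        suppCard (phaseVector sd c σ D (run sd c ord σ D δ x n)) *
          maximinValue sd c Finset.univ
            (weakPart sd (run sd c ord σ D δ x n).active) ≤
      numObs sd (run sd c ord σ D δ x (n + 1)).played i := by
  rw [run_succ_played, numObs_append, numObs_phaseList hord h1, Nat.cast_add]
  refine add_le_add le_rfl (le_trans ?_ (le_sum_playCounts sd _ hi))
  rw [phaseVector, if_pos hE, maximinValue]

/-- After the first phase every action has been observed. -/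
theorem numObs_run_pos (hK : 1 < K) (hc : IsMaximinRule sd c)
    (hord : IsPlayOrder ord) (hcov : ∀ j, ∃ i, j ∈ obsSet sd i) {n : ℕ} (hn : 1 ≤ n) (i : Fin K) :
    0 < numObs sd (run sd c ord σ D δ x n).played i := by
  induction n, hn using Nat.le_induction with
  | succ n _ ih => exact ih.trans_le (numObs_run_succ n i)
  | base =>
    have ha : (run sd c ord σ D δ x 0).active = Finset.univ := rfl
    have h1 : (run sd c ord σ D δ x 0).active.card ≠ 1 := by
      rw [ha]; simp; omega
    -- Among all actions every action is observed by someone, so the initial weak part is empty and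
    -- the first phase explores with the active set.
    have hE : ¬ ExploreWeak sd c σ D (run sd c ord σ D δ x 0) := fun h => by
      have := h.1
      rw [ha, weakPart, strongPart_univ hcov] at this
      simp at this
    have hi : i ∈ strongPart sd (run sd c ord σ D δ x 0).active := by
      rw [ha, strongPart_univ hcov]; simp
    have hg := numObs_run_succ_strong hord h1 hE hi
    have hm := inv_le_maximinValue_strongPart hc ⟨i, hi⟩
    have hne : (run sd c ord σ D δ x 0).active.Nonempty := ⟨i, by rw [ha]; simp⟩
    have hs := suppCard_pos (phaseVector_mem (σ := σ) (D := D) hc hne).1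
    have h3 : (0 : ℝ) < suppCard (phaseVector sd c σ D (run sd c ord σ D δ x 0)) := by
      exact_mod_cast hs
    have h4 : (0 : ℝ) < 1 / K := by
      have : (0 : ℝ) < K := by exact_mod_cast (by omega : 0 < K)
      positivity
    have h5 := mul_pos h3 (h4.trans_le hm)
    have h6 : (0 : ℝ) ≤ numObs sd (run sd c ord σ D δ x 0).played i := Nat.cast_nonneg _
    exact_mod_cast (by linarith : (0 : ℝ) < numObs sd (run sd c ord σ D δ x (0 + 1)).played i)

/-! ### Rounds spent on exploring with all actions -/

/-- The number of rounds of the first `n` phases that belong to phases exploring with all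
actions. -/
noncomputable def weakRounds (sd : Fin K → Fin K → ℝ≥0∞)
    (c : Finset (Fin K) → Finset (Fin K) → Fin K → ℝ) (ord : ℕ → (Fin K → ℕ) → List (Fin K))
    (σ D δ : ℝ) (x : ℕ → Fin K → Fin K → ℝ) : ℕ → ℕ
  | 0 => 0
  | n + 1 => weakRounds sd c ord σ D δ x n +
      open Classical in
      if (run sd c ord σ D δ x n).active.card ≠ 1 ∧ ExploreWeak sd c σ D (run sd c ord σ D δ x n)
      then (phaseList sd c ord σ D (n + 1) (run sd c ord σ D δ x n)).length else 0

theorem weakRounds_succ_of_explore {n : ℕ} (h1 : (run sd c ord σ D δ x n).active.card ≠ 1)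
    (hE : ExploreWeak sd c σ D (run sd c ord σ D δ x n)) :
    weakRounds sd c ord σ D δ x (n + 1) = weakRounds sd c ord σ D δ x n +
      (phaseList sd c ord σ D (n + 1) (run sd c ord σ D δ x n)).length := by
  rw [weakRounds, if_pos ⟨h1, hE⟩]

theorem weakRounds_succ_of_not {n : ℕ} (h : ¬ ((run sd c ord σ D δ x n).active.card ≠ 1 ∧
    ExploreWeak sd c σ D (run sd c ord σ D δ x n))) :
    weakRounds sd c ord σ D δ x (n + 1) = weakRounds sd c ord σ D δ x n := by
  rw [weakRounds, if_neg h, add_zero]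

/-- A member of the current strong part was in the strong part of all earlier active sets, because
those are larger. So each earlier phase outside the weak exploration contributed to its
observations, at the rate of at least `q / 2` per round. -/
theorem rounds_le_numObs_strong (hK : 0 < K) (hσ : 0 ≤ σ) (hc : IsMaximinRule sd c)
    (hord : IsPlayOrder ord) {q : ℝ} (hq : 0 ≤ q)
    (hqm : ∀ A : Finset (Fin K), 1 < A.card → (strongPart sd A).Nonempty →
      q ≤ maximinValue sd c A (strongPart sd A)) (n : ℕ)
    (hn : (run sd c ord σ D δ x n).active.card ≠ 1) {i : Fin K}
    (hi : i ∈ strongPart sd (run sd c ord σ D δ x n).active) :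
    q * ((run sd c ord σ D δ x n).played.length - weakRounds sd c ord σ D δ x n) ≤
      2 * numObs sd (run sd c ord σ D δ x n).played i := by
  induction n with
  | zero => simp [run, weakRounds]
  | succ n ih =>
    have h1 := run_card_ne_one_of_succ hn
    have hi' := strongPart_of_subset (run_succ_active_subset n) hi
    have ih := ih h1 hi'
    have hne := run_active_nonempty (sd := sd) (c := c) (ord := ord) (D := D) (δ := δ) (x := x)
      hK hσ n
    by_cases hE : ExploreWeak sd c σ D (run sd c ord σ D δ x n)
    · rw [weakRounds_succ_of_explore h1 hE]
      have h2 : (numObs sd (run sd c ord σ D δ x n).played i : ℝ) ≤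
        numObs sd (run sd c ord σ D δ x (n + 1)).played i := by exact_mod_cast numObs_run_succ n i
      rw [run_succ_played, List.length_append, ← run_succ_played]
      push_cast
      linarith
    · rw [weakRounds_succ_of_not fun h => hE h.2]
      have hcard : 1 < (run sd c ord σ D δ x n).active.card := by
        have := hne.card_pos; omega
      have h2 := numObs_run_succ_strong hord h1 hE hi'
      have h3 := hqm _ hcard ⟨i, hi'⟩
      have h4 : ((phaseList sd c ord σ D (n + 1) (run sd c ord σ D δ x n)).length : ℝ) ≤
          2 * suppCard (phaseVector sd c σ D (run sd c ord σ D δ x n)) := by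
        exact_mod_cast length_phaseList_le hc hord hne h1
      have h5 := mul_le_mul_of_nonneg_left h3
        (Nat.cast_nonneg (suppCard (phaseVector sd c σ D (run sd c ord σ D δ x n))))
      have h6 := mul_le_mul_of_nonneg_left h4 hq
      rw [run_succ_played, List.length_append, ← run_succ_played]
      push_cast
      linarith

/-- The weak part may gain members when eliminations remove their observers, so observations of a
newly weak action must be compared with weak rounds spent on others. The second bound carries one
spare phase, of at most `2K` rounds, for actions that are still strong. When such an action becomes
weak, some action has been eliminated, and the growth of `K - |A|` pays for the spare phase. Both
bounds are proved by one induction. -/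
theorem weakRounds_le_numObs (hK : 0 < K) (hσ : 0 ≤ σ) (hc : IsMaximinRule sd c)
    (hord : IsPlayOrder ord) {a : ℝ} (ha : 0 < a) (n : ℕ)
    (hn : (run sd c ord σ D δ x n).active.card ≠ 1)
    (hav : ∀ B ∈ (run sd c ord σ D δ x n).visited, (weakPart sd B).Nonempty →
      a ≤ maximinValue sd c Finset.univ (weakPart sd B)) :
    (∀ i ∈ weakPart sd (run sd c ord σ D δ x n).active,
      (weakRounds sd c ord σ D δ x n : ℝ) ≤
        2 / a * numObs sd (run sd c ord σ D δ x n).played i +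
          2 * K * (K - (run sd c ord σ D δ x n).active.card)) ∧
    ∀ i ∈ (run sd c ord σ D δ x n).active,
      (weakRounds sd c ord σ D δ x n : ℝ) ≤
        2 / a * numObs sd (run sd c ord σ D δ x n).played i +
          2 * K * (K - (run sd c ord σ D δ x n).active.card + 1) := by
  have ha2 : 0 < 2 / a := by positivity
  induction n with
  | zero =>
    have hcard : (run sd c ord σ D δ x 0).active.card = K := by simp [run]
    rw [hcard]
    constructor
    · intro i _
      simp only [weakRounds, sub_self, Nat.cast_zero]
      positivity
    · intro i _
      simp only [weakRounds, sub_self, Nat.cast_zero]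
      positivity
  | succ n ih =>
    have h1 := run_card_ne_one_of_succ hn
    obtain ⟨hvis1, -, hvis2⟩ := run_visited (sd := sd) (c := c) (ord := ord) (σ := σ) (D := D)
      (δ := δ) (x := x) n
    obtain ⟨ihW, ihA⟩ := ih h1 fun B hB => hav B (hvis2 hB)
    have hsub := run_succ_active_subset (sd := sd) (c := c) (ord := ord) (σ := σ) (D := D)
      (δ := δ) (x := x) n
    have hne := run_active_nonempty (sd := sd) (c := c) (ord := ord) (D := D) (δ := δ) (x := x)
      hK hσ n
    have hnum : ∀ i, 2 / a * (numObs sd (run sd c ord σ D δ x n).played i : ℝ) ≤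
        2 / a * numObs sd (run sd c ord σ D δ x (n + 1)).played i := fun i => by
      have : (numObs sd (run sd c ord σ D δ x n).played i : ℝ) ≤
        numObs sd (run sd c ord σ D δ x (n + 1)).played i := by exact_mod_cast numObs_run_succ n i
      gcongr
    have hKr : (0 : ℝ) ≤ 2 * K := by positivity
    have hcardle : ((run sd c ord σ D δ x (n + 1)).active.card : ℝ) ≤
        (run sd c ord σ D δ x n).active.card := by exact_mod_cast Finset.card_le_card hsub
    have hmono : 2 * (K : ℝ) * (K - (run sd c ord σ D δ x n).active.card) ≤
        2 * K * (K - (run sd c ord σ D δ x (n + 1)).active.card) := by gcongr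
    -- An action that moves from the strong to the weak part witnesses an elimination.
    have hchange : ∀ i ∈ weakPart sd (run sd c ord σ D δ x (n + 1)).active,
        i ∉ weakPart sd (run sd c ord σ D δ x n).active →
        2 * (K : ℝ) * (K - (run sd c ord σ D δ x n).active.card + 1) ≤
          2 * K * (K - (run sd c ord σ D δ x (n + 1)).active.card) := by
      intro i hi hi'
      have hss : (run sd c ord σ D δ x (n + 1)).active ⊂ (run sd c ord σ D δ x n).active :=
        Finset.ssubset_iff_subset_ne.2 ⟨hsub, fun h => hi' (h ▸ hi)⟩
      have : ((run sd c ord σ D δ x (n + 1)).active.card : ℝ) + 1 ≤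
          (run sd c ord σ D δ x n).active.card := by exact_mod_cast Finset.card_lt_card hss
      refine mul_le_mul_of_nonneg_left ?_ hKr
      linarith
    by_cases hE : ExploreWeak sd c σ D (run sd c ord σ D δ x n)
    · rw [weakRounds_succ_of_explore h1 hE, Nat.cast_add]
      have hlen : ((phaseList sd c ord σ D (n + 1) (run sd c ord σ D δ x n)).length : ℝ) ≤
          2 * suppCard (phaseVector sd c σ D (run sd c ord σ D δ x n)) := by
        exact_mod_cast length_phaseList_le hc hord hne h1
      have hlenK : ((phaseList sd c ord σ D (n + 1) (run sd c ord σ D δ x n)).length : ℝ) ≤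
          2 * K := by exact_mod_cast length_phaseList_le' hK hc hord hne
      have hW : ∀ i ∈ weakPart sd (run sd c ord σ D δ x n).active,
          (weakRounds sd c ord σ D δ x n : ℝ) +
            (phaseList sd c ord σ D (n + 1) (run sd c ord σ D δ x n)).length ≤
          2 / a * numObs sd (run sd c ord σ D δ x (n + 1)).played i +
            2 * K * (K - (run sd c ord σ D δ x n).active.card) := by
        intro i hi
        have hg := numObs_run_succ_weak hord h1 hE hi
        have hm := hav _ (hvis2 hvis1) ⟨i, hi⟩
        have h5 := mul_le_mul_of_nonneg_left hm
          (Nat.cast_nonneg (suppCard (phaseVector sd c σ D (run sd c ord σ D δ x n))))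
        have h6 : (numObs sd (run sd c ord σ D δ x n).played i : ℝ) +
            suppCard (phaseVector sd c σ D (run sd c ord σ D δ x n)) * a ≤
            numObs sd (run sd c ord σ D δ x (n + 1)).played i := by linarith
        have h7 := mul_le_mul_of_nonneg_left h6 ha2.le
        have h8 : 2 / a * ((suppCard (phaseVector sd c σ D (run sd c ord σ D δ x n)) : ℝ) * a) =
            2 * suppCard (phaseVector sd c σ D (run sd c ord σ D δ x n)) := by field_simp
        rw [mul_add, h8] at h7
        have := ihW i hi
        linarith
      have hS : ∀ i ∈ (run sd c ord σ D δ x n).active,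
          (weakRounds sd c ord σ D δ x n : ℝ) +
            (phaseList sd c ord σ D (n + 1) (run sd c ord σ D δ x n)).length ≤
          2 / a * numObs sd (run sd c ord σ D δ x (n + 1)).played i +
            2 * K * (K - (run sd c ord σ D δ x n).active.card + 1) := by
        intro i hi
        by_cases hiW : i ∈ weakPart sd (run sd c ord σ D δ x n).active
        · have := hW i hiW
          linarith
        · have hiS : i ∈ strongPart sd (run sd c ord σ D δ x n).active := by
            by_contra h
            exact hiW (mem_weakPart.2 ⟨hi, h⟩)
          -- Weak exploration requires some weak action to lag behind every strong one. The bound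
          -- for that `w` transfers to `i`, and the current phase is the spare one.
          obtain ⟨w, hw, hlt⟩ := (Finset.inf_lt_iff).1
            (hE.2.1.trans_le (Finset.inf_le (f := fun i =>
              (numObs sd (run sd c ord σ D δ x n).played i : ℕ∞)) hiS))
          have hlt' : (numObs sd (run sd c ord σ D δ x n).played w : ℝ) ≤
              numObs sd (run sd c ord σ D δ x n).played i := by
            exact_mod_cast (Nat.cast_lt.1 hlt).le
          have h7 := mul_le_mul_of_nonneg_left hlt' ha2.le
          have h8 := ihW w hw
          have h9 := hnum i
          linarith
      constructor
      · intro i hi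
        by_cases hiW : i ∈ weakPart sd (run sd c ord σ D δ x n).active
        · exact (hW i hiW).trans (by linarith)
        · exact (hS i (hsub (weakPart_subset _ _ hi))).trans (by linarith [hchange i hi hiW])
      · intro i hi
        exact (hS i (hsub hi)).trans (by linarith)
    · rw [weakRounds_succ_of_not fun h => hE h.2]
      constructor
      · intro i hi
        by_cases hiW : i ∈ weakPart sd (run sd c ord σ D δ x n).active
        · linarith [ihW i hiW, hnum i]
        · linarith [ihA i (hsub (weakPart_subset _ _ hi)), hnum i, hchange i hi hiW]
      · intro i hi
        linarith [ihA i (hsub hi), hnum i]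

/-! ### The value of `alpha` and the total length of weak exploration -/

theorem alpha_le {s : State K} {B : Finset (Fin K)} (hB : B ∈ s.visited)
    (hne : (weakPart sd B).Nonempty) :
    alpha sd c s ≤ maximinValue sd c Finset.univ (weakPart sd B) := by
  classical
  have hmem : B ∈ s.visited.filter fun A => (weakPart sd A).Nonempty := by simp [hB, hne]
  have h : (s.visited.filter fun A => (weakPart sd A).Nonempty).Nonempty := ⟨B, hmem⟩
  rw [alpha, dif_pos (by convert h)]
  exact Finset.inf'_le (fun A => maximinValue sd c Finset.univ (weakPart sd A)) (by convert hmem)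

/-- The assumption `a ≤ 1` covers the default value `1`, taken while no visited set has a weak part.
-/
theorem le_alpha {s : State K} {a : ℝ} (ha : a ≤ 1)
    (h : ∀ B ∈ s.visited, (weakPart sd B).Nonempty →
      a ≤ maximinValue sd c Finset.univ (weakPart sd B)) : a ≤ alpha sd c s := by
  rw [alpha]
  split_ifs with hne
  · refine Finset.le_inf' _ _ fun B hB => ?_
    rw [Finset.mem_filter] at hB
    exact h B hB.1 hB.2
  · exact ha

theorem inv_weakDominationNumber_le_alpha (hσ : 0 ≤ σ) (hc : IsMaximinRule sd c)
    (hcov : ∀ j, ∃ i, j ∈ obsSet sd i) (hw : WeaklyObservable sd) {n : ℕ}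
    (hn : (run sd c ord σ D δ x n).active.card ≠ 1) :
    (1 : ℝ) / weakDominationNumber sd ≤ alpha sd c (run sd c ord σ D δ x n) := by
  have hK := three_le_of_weaklyObservable hw
  have hne := (run_active_nonempty (sd := sd) (c := c) (ord := ord) (D := D) (δ := δ) (x := x)
    (by omega) hσ n).card_pos
  refine le_alpha ?_ fun B hB hBne => inv_weakDominationNumber_le hc hcov ?_ hBne
  · have : (1 : ℝ) ≤ weakDominationNumber sd := by
      exact_mod_cast weakDominationNumber_pos hcov hw
    rw [div_le_one (by linarith)]
    exact this
  · have := Finset.card_le_card ((run_visited n).2.1 B hB)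
    omega

/-- With threshold `(α s)^{2/3}` and exchange rate `2 / α`, only `α^{-1/3}` remains, and it is at
most `ρ^{1/3}`. -/
theorem alpha_rpow_bound {α s : ℝ} (hα : 0 < α) (hs : 0 ≤ s) {ρ : ℝ} (hρ : 0 < ρ)
    (h : 1 / ρ ≤ α) :
    2 / α * (α * s) ^ ((2 : ℝ) / 3) ≤ 2 * ρ ^ ((1 : ℝ) / 3) * s ^ ((2 : ℝ) / 3) := by
  rw [Real.mul_rpow hα.le hs, ← mul_assoc]
  have h1 : 2 / α * α ^ ((2 : ℝ) / 3) = 2 * (1 / α) ^ ((1 : ℝ) / 3) := by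
    have h2 : α = α ^ ((2 : ℝ) / 3) * α ^ ((1 : ℝ) / 3) := by
      rw [← Real.rpow_add hα]; norm_num
    have h3 : (1 / α) ^ ((1 : ℝ) / 3) = 1 / α ^ ((1 : ℝ) / 3) := by
      rw [Real.div_rpow zero_le_one hα.le, Real.one_rpow]
    have h4 : 0 < α ^ ((2 : ℝ) / 3) := Real.rpow_pos_of_pos hα _
    have h5 : 0 < α ^ ((1 : ℝ) / 3) := Real.rpow_pos_of_pos hα _
    rw [h3]
    nth_rewrite 1 [h2]
    field_simp
  rw [h1]
  have h6 : 1 / α ≤ ρ := by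
    rw [div_le_iff₀ hα]; rw [div_le_iff₀ hρ] at h; linarith
  gcongr

/-- Only the last phase of weak exploration matters. At its start some weak action has fewer than
`γ` observations, which bounds the earlier weak rounds through `weakRounds_le_numObs`; the phase
itself adds at most `2K`. Later phases only increase the elapsed time on the right. -/
theorem weakRounds_succ_le (hσ : 0 ≤ σ) (hD : 0 < D) (hc : IsMaximinRule sd c)
    (hord : IsPlayOrder ord) (hcov : ∀ j, ∃ i, j ∈ obsSet sd i) (hw : WeaklyObservable sd) (n : ℕ) :
    (weakRounds sd c ord σ D δ x (n + 1) : ℝ) ≤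
      2 * (weakDominationNumber sd : ℝ) ^ ((1 : ℝ) / 3) *
        (σ * (run sd c ord σ D δ x n).played.length / D) ^ ((2 : ℝ) / 3) + 2 * K * (K - 1) := by
  have hK := three_le_of_weaklyObservable hw
  have hK3 : (3 : ℝ) ≤ K := by exact_mod_cast hK
  have hρ : (0 : ℝ) < weakDominationNumber sd := by
    exact_mod_cast weakDominationNumber_pos hcov hw
  induction n with
  | zero =>
    have hE : ¬ ExploreWeak sd c σ D (run sd c ord σ D δ x 0) := fun h => by
      have := h.1
      rw [show (run sd c ord σ D δ x 0).active = Finset.univ from rfl, weakPart,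
        strongPart_univ hcov] at this
      simp at this
    rw [weakRounds_succ_of_not fun h => hE h.2]
    have : (0 : ℝ) ≤ 2 * K * (K - 1) := by nlinarith
    simp only [weakRounds, Nat.cast_zero]
    positivity
  | succ n ih =>
    by_cases h : (run sd c ord σ D δ x (n + 1)).active.card ≠ 1 ∧
        ExploreWeak sd c σ D (run sd c ord σ D δ x (n + 1))
    · obtain ⟨h1, hE⟩ := h
      rw [weakRounds_succ_of_explore h1 hE, Nat.cast_add]
      have hα := inv_weakDominationNumber_le_alpha hσ hc hcov hw h1
      have hα0 : 0 < alpha sd c (run sd c ord σ D δ x (n + 1)) := lt_of_lt_of_le (by positivity) hα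
      obtain ⟨w, hwW, hwγ⟩ := hE.2.2
      have h2 := (weakRounds_le_numObs (by omega) hσ hc hord hα0 (n + 1) h1
        fun B hB hBne => alpha_le hB hBne).1 w hwW
      have h3 : 2 / alpha sd c (run sd c ord σ D δ x (n + 1)) *
          (numObs sd (run sd c ord σ D δ x (n + 1)).played w : ℝ) ≤
          2 * (weakDominationNumber sd : ℝ) ^ ((1 : ℝ) / 3) *
            (σ * (run sd c ord σ D δ x (n + 1)).played.length / D) ^ ((2 : ℝ) / 3) := by
        refine le_trans ?_ (alpha_rpow_bound hα0 (by positivity) hρ hα)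
        refine mul_le_mul_of_nonneg_left ?_ (by positivity)
        refine hwγ.le.trans (le_of_eq ?_)
        rw [gammaThreshold]
        congr 1
        ring
      have hne := run_active_nonempty (sd := sd) (c := c) (ord := ord) (D := D) (δ := δ) (x := x)
        (by omega : 0 < K) hσ (n + 1)
      have h4 : ((phaseList sd c ord σ D (n + 1 + 1) (run sd c ord σ D δ x (n + 1))).length : ℝ) ≤
          2 * K := by exact_mod_cast length_phaseList_le' (by omega) hc hord hne
      -- Two active actions leave an overhead of `2K(K - 2)`, so the current phase of at most `2K`
      -- rounds still fits into `2K(K - 1)`.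
      have h5 : (2 : ℝ) ≤ (run sd c ord σ D δ x (n + 1)).active.card := by
        have := hne.card_pos
        exact_mod_cast (by omega : 2 ≤ (run sd c ord σ D δ x (n + 1)).active.card)
      have h6 : 2 * (K : ℝ) * (K - (run sd c ord σ D δ x (n + 1)).active.card) ≤
          2 * K * (K - 2) := by gcongr
      linarith
    · rw [weakRounds_succ_of_not h]
      refine ih.trans ?_
      have : ((run sd c ord σ D δ x n).played.length : ℝ) ≤
          (run sd c ord σ D δ x (n + 1)).played.length := by
        rw [run_succ_played, List.length_append]
        push_cast
        exact le_add_of_nonneg_right (Nat.cast_nonneg _)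
      gcongr

end Phases

/-! ### Dominating sets of strongly observable structures -/

section Graph

variable {K : ℕ} {sd : Fin K → Fin K → ℝ≥0∞}

/-- The other members of `U` that `j` observes. -/
noncomputable def outNbrs (sd : Fin K → Fin K → ℝ≥0∞) (U : Finset (Fin K)) (j : Fin K) : Finset (Fin K) :=
  (obsSet sd j ∩ U).erase j

/-- In-degrees and out-degrees have the same sum, so some vertex also has in-degree at most `d`.
Select it, delete it together with its at most `2d` neighbours, and repeat. -/
theorem exists_independent_of_outNbrs_le (d : ℕ) (U : Finset (Fin K))
    (h : ∀ j ∈ U, (outNbrs sd U j).card ≤ d) :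
    ∃ I ⊆ U, IsIndependent sd I ∧ U.card ≤ (2 * d + 1) * I.card := by
  induction hn : U.card using Nat.strong_induction_on generalizing U with
  | _ n ih =>
  subst hn
  rcases U.eq_empty_or_nonempty with rfl | hU
  · exact ⟨∅, subset_rfl, by simp [IsIndependent], by simp⟩
  -- Some vertex has in-degree at most `d`.
  obtain ⟨i, hiU, hi⟩ : ∃ i ∈ U, (U.filter fun j => i ∈ outNbrs sd U j).card ≤ d := by
    by_contra! hcon
    have h1 : ∑ i ∈ U, (U.filter fun j => i ∈ outNbrs sd U j).card =
        ∑ j ∈ U, (outNbrs sd U j).card := by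
      simp only [Finset.card_filter]
      rw [Finset.sum_comm]
      refine Finset.sum_congr rfl fun j _ => ?_
      rw [← Finset.card_filter]
      congr 1
      ext l
      simp only [Finset.mem_filter, outNbrs, Finset.mem_erase, Finset.mem_inter]
      tauto
    have h2 : ∑ i ∈ U, (U.filter fun j => i ∈ outNbrs sd U j).card ≥ ∑ _i ∈ U, (d + 1) :=
      Finset.sum_le_sum fun i hi => hcon i hi
    have h3 : ∑ j ∈ U, (outNbrs sd U j).card ≤ ∑ _j ∈ U, d := Finset.sum_le_sum h
    simp only [Finset.sum_const, smul_eq_mul, mul_add, mul_one] at h2 h3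
    have := hU.card_pos
    omega
  let N := insert i (outNbrs sd U i ∪ U.filter fun j => i ∈ outNbrs sd U j)
  have hN : N.card ≤ 2 * d + 1 := by
    refine (Finset.card_insert_le _ _).trans ?_
    have := Finset.card_union_le (outNbrs sd U i) (U.filter fun j => i ∈ outNbrs sd U j)
    have := h i hiU
    omega
  have hiN : i ∈ N := Finset.mem_insert_self _ _
  have hlt : (U \ N).card < U.card :=
    Finset.card_lt_card ⟨Finset.sdiff_subset, fun hsub => by
      have := hsub hiU
      simp [hiN] at this⟩
  obtain ⟨I, hIU, hI, hIc⟩ := ih _ hlt (U \ N) (fun j hj => by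
    refine (Finset.card_le_card ?_).trans (h j (Finset.mem_sdiff.1 hj).1)
    exact Finset.erase_subset_erase _
      (Finset.inter_subset_inter subset_rfl Finset.sdiff_subset)) rfl
  have hiI : i ∉ I := fun hi' => (Finset.mem_sdiff.1 (hIU hi')).2 hiN
  refine ⟨insert i I, Finset.insert_subset hiU (hIU.trans Finset.sdiff_subset), ?_, ?_⟩
  · intro a ha b hb
    rw [Finset.mem_inter, Finset.mem_insert] at hb
    rw [Finset.mem_singleton]
    by_contra hba
    rcases Finset.mem_insert.1 ha with rfl | ha2
    · rcases hb.2 with rfl | hb2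
      · exact hba rfl
      · obtain ⟨hbU, hbN⟩ := Finset.mem_sdiff.1 (hIU hb2)
        refine hbN (Finset.mem_insert_of_mem (Finset.mem_union_left _ ?_))
        simp [outNbrs, hba, hb.1, hbU]
    · rcases hb.2 with rfl | hb2
      · obtain ⟨haU, haN⟩ := Finset.mem_sdiff.1 (hIU ha2)
        refine haN (Finset.mem_insert_of_mem (Finset.mem_union_right _ ?_))
        simp [outNbrs, hba, hb.1, hiU, haU]
      · exact hba (by simpa using hI a ha2 (Finset.mem_inter.2 ⟨hb.1, hb2⟩))
  · rw [Finset.card_insert_of_notMem hiI]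
    have h4 : U.card ≤ (U \ N).card + N.card := by
      have := Finset.le_card_sdiff N U
      omega
    calc U.card ≤ (U \ N).card + N.card := h4
      _ ≤ (2 * d + 1) * I.card + (2 * d + 1) := add_le_add hIc hN
      _ = _ := by ring

theorem card_le_independenceNumber {I : Finset (Fin K)} (hI : IsIndependent sd I) :
    I.card ≤ independenceNumber sd := by
  classical
  rw [independenceNumber]
  exact Finset.le_sup (f := Finset.card) (by simp [hI])

/-- Take `d` to be the maximal out-degree in the preceding lemma: if all out-degrees were small,
there would be an independent set that is too large. -/
theorem exists_card_le_outNbrs {U : Finset (Fin K)} (hU : U.Nonempty) :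
    ∃ j ∈ U, U.card ≤ (2 * (outNbrs sd U j).card + 1) * independenceNumber sd := by
  obtain ⟨j, hj, hmax⟩ := Finset.exists_max_image U (fun j => (outNbrs sd U j).card) hU
  obtain ⟨I, -, hI, hIc⟩ := exists_independent_of_outNbrs_le _ U hmax
  exact ⟨j, hj, hIc.trans (Nat.mul_le_mul_left _ (card_le_independenceNumber hI))⟩

/-- Greedy domination: while `|U| > 2κ`, a vertex of maximal out-degree observes at least the
fraction `1 / (4κ)` of `U`, so `log |U|` drops by at least `1 / (4κ)` if anything remains. The last
at most `2κ` vertices receive one observer each. -/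
theorem exists_dominates_card_le {A : Finset (Fin K)} (hA : ∀ i ∈ A, ∃ j ∈ A, i ∈ obsSet sd j)
    (U : Finset (Fin K)) (hUA : U ⊆ A) :
    ∃ B ⊆ A, Dominates sd B U ∧ (B.card : ℝ) ≤
      2 * independenceNumber sd + 4 * independenceNumber sd * Real.log U.card := by
  induction hn : U.card using Nat.strong_induction_on generalizing U with
  | _ n ih =>
  subst hn
  have hκ0 : (0 : ℝ) ≤ independenceNumber sd := Nat.cast_nonneg _
  have hlog : 0 ≤ Real.log U.card := Real.log_natCast_nonneg _
  by_cases hsmall : U.card ≤ 2 * independenceNumber sd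
  · choose! f hfA hf using hA
    refine ⟨U.image f, ?_, fun i hi => ⟨f i, Finset.mem_image_of_mem f hi, hf i (hUA hi)⟩, ?_⟩
    · exact Finset.image_subset_iff.2 fun i hi => hfA i (hUA hi)
    · have h1 : ((U.image f).card : ℝ) ≤ 2 * independenceNumber sd := by
        exact_mod_cast Finset.card_image_le.trans hsmall
      have : 0 ≤ 4 * (independenceNumber sd : ℝ) * Real.log U.card := by positivity
      linarith
  · push Not at hsmall
    have hUne : U.Nonempty := Finset.card_pos.1 (by omega)
    obtain ⟨j, hjU, hj⟩ := exists_card_le_outNbrs (sd := sd) hUne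
    have hκ1 : 0 < independenceNumber sd := by
      by_contra h
      rw [Nat.eq_zero_of_not_pos h, mul_zero] at hj
      have := hUne.card_pos
      omega
    have hκ : (0 : ℝ) < independenceNumber sd := by exact_mod_cast hκ1
    have hu : (0 : ℝ) < U.card := by exact_mod_cast hUne.card_pos
    set o := (outNbrs sd U j).card with ho
    -- As `|U| > 2κ`, the summand `κ` in `(2o + 1)κ` is less than `|U| / 2` and can be absorbed.
    have ho1 : (U.card : ℝ) ≤ 4 * independenceNumber sd * o := by
      have h1 : (U.card : ℝ) ≤ (2 * o + 1) * independenceNumber sd := by exact_mod_cast hj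
      have h2 : 2 * (independenceNumber sd : ℝ) < U.card := by exact_mod_cast hsmall
      linarith
    have hsub : U \ obsSet sd j ⊆ U \ outNbrs sd U j := by
      refine Finset.sdiff_subset_sdiff subset_rfl ?_
      exact (Finset.erase_subset _ _).trans Finset.inter_subset_left
    have hcard : (U \ obsSet sd j).card + o ≤ U.card := by
      have h1 := Finset.card_le_card hsub
      have h2 : outNbrs sd U j ⊆ U := (Finset.erase_subset _ _).trans Finset.inter_subset_right
      rw [Finset.card_sdiff_of_subset h2] at h1
      have := Finset.card_le_card h2
      omega
    have hopos : 0 < o := by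
      by_contra h
      rw [Nat.eq_zero_of_not_pos h] at ho1
      simp at ho1
      exact hUne.ne_empty ho1
    obtain ⟨B, hBA, hB, hBc⟩ := ih _ (by omega) (U \ obsSet sd j)
      (Finset.sdiff_subset.trans hUA) rfl
    have hdom : Dominates sd (insert j B) U := by
      intro l hl
      by_cases hlj : l ∈ obsSet sd j
      · exact ⟨j, Finset.mem_insert_self _ _, hlj⟩
      · obtain ⟨b, hb, hbl⟩ := hB l (Finset.mem_sdiff.2 ⟨hl, hlj⟩)
        exact ⟨b, Finset.mem_insert_of_mem hb, hbl⟩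
    rcases (U \ obsSet sd j).eq_empty_or_nonempty with hemp | hne
    · refine ⟨{j}, by simpa using hUA hjU, fun l hl => ⟨j, by simp, ?_⟩, ?_⟩
      · by_contra h
        have : l ∈ U \ obsSet sd j := Finset.mem_sdiff.2 ⟨hl, h⟩
        simp [hemp] at this
      · have h1 : (1 : ℝ) ≤ independenceNumber sd := by exact_mod_cast hκ1
        have : 0 ≤ 4 * (independenceNumber sd : ℝ) * Real.log U.card := by positivity
        simp
        linarith
    · refine ⟨insert j B, Finset.insert_subset (hUA hjU) hBA, hdom, ?_⟩
      have hu' : (0 : ℝ) < (U \ obsSet sd j).card := by exact_mod_cast hne.card_pos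
      have h1 : ((insert j B).card : ℝ) ≤ B.card + 1 := by
        exact_mod_cast Finset.card_insert_le _ _
      have h2 : Real.log (U \ obsSet sd j).card ≤ Real.log U.card - o / U.card := by
        have h3 := Real.log_le_sub_one_of_pos (div_pos hu' hu)
        rw [Real.log_div hu'.ne' hu.ne'] at h3
        have h4 : ((U \ obsSet sd j).card : ℝ) + o ≤ U.card := by exact_mod_cast hcard
        have h5 : ((U \ obsSet sd j).card : ℝ) / U.card ≤ 1 - o / U.card := by
          rw [one_sub_div hu.ne']
          gcongr
          linarith
        linarith
      have h6 : 1 ≤ 4 * (independenceNumber sd : ℝ) * (o / U.card) := by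
        rw [mul_div_assoc', le_div_iff₀ hu]
        linarith
      have h7 := mul_le_mul_of_nonneg_left h2 (by positivity : 0 ≤ 4 * (independenceNumber sd : ℝ))
      rw [mul_sub] at h7
      linarith

theorem strongPart_eq_of_stronglyObservable (hcov : ∀ j, ∃ i, j ∈ obsSet sd i)
    (hs : StronglyObservable sd) {A : Finset (Fin K)} (hA : 1 < A.card) : strongPart sd A = A := by
  have h := weakPart_subset_weakSet hcov hA
  rw [show weakSet sd = ∅ from hs, Finset.subset_empty, weakPart, Finset.sdiff_eq_empty_iff_subset]
    at h
  exact (strongPart_subset sd A).antisymm h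

theorem independenceNumber_pos (hK : 0 < K) : 0 < independenceNumber sd := by
  have : IsIndependent sd {(⟨0, hK⟩ : Fin K)} := fun i hi => by
    rw [Finset.mem_singleton] at hi
    subst hi
    exact Finset.inter_subset_right
  have := card_le_independenceNumber this
  simpa [Nat.lt_iff_add_one_le] using this

/-- Strong observability makes `A` its own strong part, so the greedy set dominates it. The constant
`50` is far from tight: since `log K ≥ 0.69`, it dominates `2κ + 4κ log K` with room to spare, and
it is the value that gives the constant `80` in the regret bound. -/
theorem maximinValue_strong_ge {c : Finset (Fin K) → Finset (Fin K) → Fin K → ℝ}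
    (hc : IsMaximinRule sd c) (hcov : ∀ j, ∃ i, j ∈ obsSet sd i) (hs : StronglyObservable sd)
    {A : Finset (Fin K)} (hA : 1 < A.card) :
    1 / (50 * independenceNumber sd * Real.log K) ≤ maximinValue sd c A (strongPart sd A) := by
  have hAS := strongPart_eq_of_stronglyObservable hcov hs hA
  have hAne : A.Nonempty := Finset.card_pos.1 (by omega)
  obtain ⟨B, hBA, hB, hBc⟩ := exists_dominates_card_le
    (fun i hi => (mem_strongPart.1 (hAS.symm ▸ hi : i ∈ strongPart sd A)).2) A subset_rfl
  have hAK : A.card ≤ K := (Finset.card_le_univ _).trans (by simp)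
  have hlog2 : (0.69 : ℝ) ≤ Real.log K := by
    have h1 := Real.log_two_gt_d9
    have h2 : Real.log 2 ≤ Real.log K :=
      Real.log_le_log two_pos (by exact_mod_cast (by omega : 2 ≤ K))
    linarith
  have hlogA : Real.log A.card ≤ Real.log K := by
    refine Real.log_le_log ?_ ?_
    · exact_mod_cast hAne.card_pos
    · exact_mod_cast hAK
  have hκ0 : (0 : ℝ) ≤ independenceNumber sd := Nat.cast_nonneg _
  rw [hAS]
  refine le_trans ?_ (inv_card_le_maximinValue hc hAne hBA hB)
  have hBpos : (0 : ℝ) < B.card := by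
    obtain ⟨i, hi⟩ := hAne
    obtain ⟨j, hj, -⟩ := hB i hi
    exact_mod_cast Finset.card_pos.2 ⟨j, hj⟩
  refine one_div_le_one_div_of_le hBpos (hBc.trans ?_)
  have h3 := mul_le_mul_of_nonneg_left hlogA (by positivity : 0 ≤ 4 * (independenceNumber sd : ℝ))
  have h4 := mul_le_mul_of_nonneg_left hlog2 hκ0
  nlinarith

end Graph

/-! ### Observations and the information available before a round -/

section Information

variable {Ω : Type*} {K : ℕ}

/-- The vector of all observable coordinates of round `t`. -/
def obsVec (sd : Fin K → Fin K → ℝ≥0∞) (X : ℕ → Fin K → Fin K → Ω → ℝ) (t : ℕ) (ω : Ω) :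
    {p : Fin K × Fin K // p.2 ∈ obsSet sd p.1} → ℝ := fun p => X t p.1.1 p.1.2 ω

/-- The information carried by the observable coordinates of round `t`. -/
@[reducible] def roundInfo (sd : Fin K → Fin K → ℝ≥0∞) (X : ℕ → Fin K → Fin K → Ω → ℝ) (t : ℕ) :
    MeasurableSpace Ω := MeasurableSpace.comap (obsVec sd X t) inferInstance

/-- The information carried by the observable coordinates of the rounds before `t`. -/
@[reducible] def past (sd : Fin K → Fin K → ℝ≥0∞) (X : ℕ → Fin K → Fin K → Ω → ℝ) (t : ℕ) :
    MeasurableSpace Ω := ⨆ s ∈ Set.Iio t, roundInfo sd X s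

variable {sd : Fin K → Fin K → ℝ≥0∞} {X : ℕ → Fin K → Fin K → Ω → ℝ}

theorem measurable_roundInfo (t : ℕ) {i j : Fin K} (h : j ∈ obsSet sd i) :
    Measurable[roundInfo sd X t] (X t i j) := by
  have h1 : Measurable[roundInfo sd X t] (obsVec sd X t) := comap_measurable _
  exact (measurable_pi_apply (⟨(i, j), h⟩ : {p : Fin K × Fin K // p.2 ∈ obsSet sd p.1})).comp h1

theorem past_mono {s t : ℕ} (h : s ≤ t) : past sd X s ≤ past sd X t :=
  biSup_mono fun _ hu => lt_of_lt_of_le hu h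

theorem roundInfo_le_past {s t : ℕ} (h : s < t) : roundInfo sd X s ≤ past sd X t :=
  le_iSup₂_of_le s h le_rfl

theorem measurable_past {s t : ℕ} (hst : s < t) {i j : Fin K} (h : j ∈ obsSet sd i) :
    Measurable[past sd X t] (X s i j) :=
  (measurable_roundInfo s h).mono (roundInfo_le_past hst) le_rfl

variable [MeasurableSpace Ω] {μ : Measure Ω} {θ : Fin K → ℝ}

theorem IsEnvironment.roundInfo_le (hX : IsEnvironment μ sd θ X) (t : ℕ) :
    roundInfo sd X t ≤ ‹MeasurableSpace Ω› := by
  refine Measurable.comap_le ?_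
  exact measurable_pi_lambda _ fun p => hX.measurable t p.1.1 p.1.2 p.2

theorem IsEnvironment.past_le (hX : IsEnvironment μ sd θ X) (t : ℕ) :
    past sd X t ≤ ‹MeasurableSpace Ω› :=
  iSup₂_le fun s _ => hX.roundInfo_le s

theorem IsEnvironment.indep_past (hX : IsEnvironment μ sd θ X) (t : ℕ) :
    Indep (past sd X t) (roundInfo sd X t) μ := by
  have h := indep_iSup_of_disjoint (fun s => hX.roundInfo_le s) hX.indep_rounds.iIndep
    (S := Set.Iio t) (T := {t}) (by simp)
  simpa [past, roundInfo, obsVec] using h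

end Information

/-! ### Products of predictable factors -/

/-- The factor `V t q` is independent of the past and has mean one, whatever `q` is; letting the
past choose `q` therefore leaves the mean of the product unchanged. The index type is finite, so the
choice can be resolved by a sum over its values. -/
theorem lintegral_prod_predictable {Ω ι : Type*} [Fintype ι] {m0 : MeasurableSpace Ω}
    {μ : Measure Ω} [IsProbabilityMeasure μ] {F G : ℕ → MeasurableSpace Ω}
    (hF : ∀ t, F t ≤ m0) (hG : ∀ t, G t ≤ m0) (hmono : ∀ t, F t ≤ F (t + 1))
    (hGF : ∀ t, G t ≤ F (t + 1)) (hind : ∀ t, Indep (F t) (G t) μ)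
    {Q : ℕ → Ω → ι} (hQ : ∀ t q, MeasurableSet[F t] {ω | Q t ω = q})
    {V : ℕ → ι → Ω → ℝ≥0∞} (hV : ∀ t q, Measurable[G t] (V t q))
    (hV1 : ∀ t q, ∫⁻ ω, V t q ω ∂μ = 1) (n : ℕ) :
    Measurable[F n] (fun ω => ∏ s ∈ Finset.range n, V s (Q s ω) ω) ∧
      ∫⁻ ω, ∏ s ∈ Finset.range n, V s (Q s ω) ω ∂μ = 1 := by
  classical
  have hsplit : ∀ t ω, V t (Q t ω) ω = ∑ q, {ω | Q t ω = q}.indicator 1 ω * V t q ω := by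
    intro t ω
    rw [Finset.sum_eq_single (Q t ω)]
    · simp
    · intro b _ hb
      rw [Set.indicator_of_notMem (by simpa using hb.symm), zero_mul]
    · simp
  induction n with
  | zero => simp
  | succ n ih =>
    obtain ⟨ihm, ihi⟩ := ih
    have hind1 : ∀ q, Measurable[F n] ({ω | Q n ω = q}.indicator (1 : Ω → ℝ≥0∞)) := fun q => by
      have h1 : Measurable[F n] (1 : Ω → ℝ≥0∞) := @measurable_const _ _ _ (F n) 1
      exact h1.indicator (hQ n q)
    have hmeas : ∀ q, Measurable[F n] (fun ω => (∏ s ∈ Finset.range n, V s (Q s ω) ω) *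
        {ω | Q n ω = q}.indicator 1 ω) := fun q => ihm.mul (hind1 q)
    have heq : ∀ ω, ∏ s ∈ Finset.range (n + 1), V s (Q s ω) ω =
        ∑ q, ((∏ s ∈ Finset.range n, V s (Q s ω) ω) * {ω | Q n ω = q}.indicator 1 ω) *
          V n q ω := by
      intro ω
      rw [Finset.prod_range_succ, hsplit n ω, Finset.mul_sum]
      exact Finset.sum_congr rfl fun q _ => by rw [mul_assoc]
    simp only [heq]
    constructor
    · refine Finset.measurable_fun_sum _ fun q _ => ?_
      exact ((hmeas q).mono (hmono n) le_rfl).mul ((hV n q).mono (hGF n) le_rfl)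
    · have hm : ∀ q, Measurable fun ω => ((∏ s ∈ Finset.range n, V s (Q s ω) ω) *
          {ω | Q n ω = q}.indicator 1 ω) * V n q ω := fun q =>
        ((hmeas q).mono (hF n) le_rfl).mul ((hV n q).mono (hG n) le_rfl)
      rw [lintegral_finsetSum _ fun q _ => hm q]
      rw [Finset.sum_congr rfl fun q _ =>
        (lintegral_mul_eq_lintegral_mul_lintegral_of_independent_measurableSpace (hF n) (hG n)
          (hind n) (hmeas q) (hV n q)).trans (by rw [hV1, mul_one])]
      rw [← lintegral_finsetSum _ fun q _ => (hmeas q).mono (hF n) le_rfl, ← ihi]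
      refine lintegral_congr fun ω => ?_
      rw [← Finset.mul_sum, Finset.sum_eq_single (Q n ω)]
      · simp
      · intro b _ hb
        exact Set.indicator_of_notMem (by simpa using hb.symm) _
      · simp

/-! ### The algorithm is adapted -/

section Adapted

variable {Ω : Type*} {K : ℕ} {sd : Fin K → Fin K → ℝ≥0∞} {X : ℕ → Fin K → Fin K → Ω → ℝ}
  {c : Finset (Fin K) → Finset (Fin K) → Fin K → ℝ} {ord : ℕ → (Fin K → ℕ) → List (Fin K)}
  {σ D δ : ℝ}

/-- Countability allows events to be decomposed by the value of the random state. -/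
instance countable_state : Countable (State K) := by
  have : Function.Injective
      (fun s : State K => (s.played, s.active, s.visited)) := by
    rintro ⟨a, b, c⟩ ⟨a', b', c'⟩ h
    simpa using h
  exact this.countable

theorem measurable_empMean (h : List (Fin K)) (i : Fin K) :
    Measurable[past sd X h.length] (fun ω => empMean sd (fun t i j => X t i j ω) h i) := by
  unfold empMean
  refine Measurable.div_const ?_ _
  refine Finset.measurable_fun_sum _ fun t ht => ?_
  exact measurable_past t.2 (by simpa using ht)

theorem measurableSet_survivors_eq (h : List (Fin K)) (r : ℕ) (A B : Finset (Fin K)) :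
    MeasurableSet[past sd X h.length]
      {ω | survivors sd σ δ (fun t i j => X t i j ω) h r A = B} := by
  have h1 : {ω | survivors sd σ δ (fun t i j => X t i j ω) h r A = B} =
      ⋂ i, {ω | i ∈ survivors sd σ δ (fun t i j => X t i j ω) h r A ↔ i ∈ B} := by
    ext ω
    simp [Finset.ext_iff]
  rw [h1]
  refine MeasurableSet.iInter fun i => ?_
  refine MeasurableSet.iff ?_ (MeasurableSet.const _)
  simp only [mem_survivors]
  refine MeasurableSet.inter (MeasurableSet.const _) ?_
  have h2 : {ω | ∀ j ∈ A, empMean sd (fun t i j => X t i j ω) h j - confRadius sd σ δ h r j ≤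
      empMean sd (fun t i j => X t i j ω) h i + confRadius sd σ δ h r i} =
      ⋂ j ∈ A, {ω | empMean sd (fun t i j => X t i j ω) h j - confRadius sd σ δ h r j ≤
      empMean sd (fun t i j => X t i j ω) h i + confRadius sd σ δ h r i} := by
    ext ω
    simp
  change MeasurableSet[past sd X h.length] {ω | _}
  rw [h2]
  refine Finset.measurableSet_biInter _ fun j _ => ?_
  exact @measurableSet_le _ _ _ _ _ (past sd X h.length) _ _ _ _ _
    ((measurable_empMean h j).sub_const _) ((measurable_empMean h i).add_const _)

theorem measurableSet_phaseStep_eq (r : ℕ) (s s' : State K) :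
    MeasurableSet[past sd X s'.played.length]
      {ω | phaseStep sd c ord σ D δ (fun t i j => X t i j ω) r s = s'} := by
  by_cases h1 : s.active.card = 1
  · simp only [phaseStep, if_pos h1]
    exact MeasurableSet.const _
  · simp only [phaseStep, if_neg h1]
    set h := s.played ++ ord r (playCounts (phaseVector sd c σ D s)) with hh
    by_cases h2 : h = s'.played
    · have h3 : {ω | State.mk h (survivors sd σ δ (fun t i j => X t i j ω) h (r + 1) s.active)
          (insert (survivors sd σ δ (fun t i j => X t i j ω) h (r + 1) s.active) s.visited) = s'} =
          {ω | survivors sd σ δ (fun t i j => X t i j ω) h (r + 1) s.active = s'.active} ∩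
            {_ω | insert s'.active s.visited = s'.visited} := by
        obtain ⟨p, a, v⟩ := s'
        ext ω
        simp only [State.mk.injEq, Set.mem_ofPred_eq, Set.mem_inter_iff] at h2 ⊢
        constructor
        · rintro ⟨-, ha, hv⟩
          rw [ha] at hv
          exact ⟨ha, hv⟩
        · rintro ⟨ha, hv⟩
          rw [← ha] at hv
          exact ⟨h2, ha, hv⟩
      rw [h3, ← h2]
      exact (measurableSet_survivors_eq h _ _ _).inter (MeasurableSet.const _)
    · have h3 : {ω | State.mk h (survivors sd σ δ (fun t i j => X t i j ω) h (r + 1) s.active)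
          (insert (survivors sd σ δ (fun t i j => X t i j ω) h (r + 1) s.active) s.visited) = s'} =
          ∅ := by
        ext ω
        simp only [Set.mem_ofPred_eq, Set.mem_empty_iff_false, iff_false]
        rintro rfl
        exact h2 rfl
      rw [h3]
      exact @MeasurableSet.empty _ (past sd X s'.played.length)

/-- The number of rounds before a phase is random, but the value `s` of the state determines it. So
the event belongs to the past of the deterministic time `s.played.length`, as for a stopping time;
no coarser bound on the time is used. -/
theorem measurableSet_run_eq (n : ℕ) (s : State K) :
    MeasurableSet[past sd X s.played.length]
      {ω | run sd c ord σ D δ (fun t i j => X t i j ω) n = s} := by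
  induction n generalizing s with
  | zero =>
    simp only [run]
    exact MeasurableSet.const _
  | succ n ih =>
    have h1 : {ω | run sd c ord σ D δ (fun t i j => X t i j ω) (n + 1) = s} =
        ⋃ u : State K, {ω | run sd c ord σ D δ (fun t i j => X t i j ω) n = u} ∩
          {ω | phaseStep sd c ord σ D δ (fun t i j => X t i j ω) (n + 1) u = s} := by
      ext ω
      simp [run_succ]
    rw [h1]
    refine MeasurableSet.iUnion fun u => ?_
    -- The plays of a phase depend only on the state at its start. Incompatible pairs `u`, `s`
    -- contribute nothing, and for compatible ones the past of `u` is contained in that of `s`.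
    by_cases hu : u.played ++ phaseList sd c ord σ D (n + 1) u = s.played
    · refine MeasurableSet.inter (past_mono ?_ _ (ih u)) (measurableSet_phaseStep_eq _ _ _)
      rw [← hu, List.length_append]
      omega
    · have h2 : {ω | phaseStep sd c ord σ D δ (fun t i j => X t i j ω) (n + 1) u = s} = ∅ := by
        ext ω
        simp only [Set.mem_ofPred_eq, Set.mem_empty_iff_false, iff_false]
        intro h
        exact hu (by rw [← h, phaseStep_played])
      rw [h2, Set.inter_empty]
      exact @MeasurableSet.empty _ (past sd X s.played.length)

theorem run_played_prefix {x : ℕ → Fin K → Fin K → ℝ} {n m : ℕ} (h : n ≤ m) :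
    (run sd c ord σ D δ x n).played <+: (run sd c ord σ D δ x m).played := by
  induction m, h using Nat.le_induction with
  | base => exact List.prefix_rfl
  | succ m _ ih =>
    rw [run_succ_played]
    exact ih.trans (List.prefix_append _ _)

theorem take_eq_take_of_prefix {α : Type*} {l l' : List α} (h : l <+: l') {t : ℕ}
    (ht : t ≤ l.length) : l'.take t = l.take t := by
  obtain ⟨m, rfl⟩ := h
  rw [List.take_append_of_le_length ht]

theorem run_take_eq {x : ℕ → Fin K → Fin K → ℝ} {n m t : ℕ}
    (hn : t ≤ (run sd c ord σ D δ x n).played.length)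
    (hm : t ≤ (run sd c ord σ D δ x m).played.length) :
    (run sd c ord σ D δ x n).played.take t = (run sd c ord σ D δ x m).played.take t := by
  rcases le_total n m with h | h
  · exact (take_eq_take_of_prefix (run_played_prefix h) hn).symm
  · exact take_eq_take_of_prefix (run_played_prefix h) hm

/-- The first `t + 1` actions are determined by the observations of the first `t` rounds. -/
theorem measurableSet_actions_eq (hK : 0 < K) (hσ : 0 ≤ σ) (hc : IsMaximinRule sd c)
    (hord : IsPlayOrder ord) (t : ℕ) (h : List (Fin K)) :
    MeasurableSet[past sd X t]
      {ω | actions sd c ord σ D δ (fun t i j => X t i j ω) (t + 1) = h} := by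
  -- Split according to the phase that contains round `t` and the state at its start. That state was
  -- fixed by time `t`, and it fixes the order of all plays of the phase.
  have h1 : {ω | actions sd c ord σ D δ (fun t i j => X t i j ω) (t + 1) = h} =
      ⋃ n : ℕ, ⋃ u : State K, {ω | run sd c ord σ D δ (fun t i j => X t i j ω) n = u} ∩
        {_ω | u.played.length ≤ t ∧
          t < (u.played ++ phaseList sd c ord σ D (n + 1) u).length ∧
          (u.played ++ phaseList sd c ord σ D (n + 1) u).take (t + 1) = h} := by
    ext ω
    simp only [Set.mem_ofPred_eq, Set.mem_iUnion, Set.mem_inter_iff, exists_eq_left']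
    simp only [← run_succ_played]
    have hlen := le_length_run (sd := sd) (c := c) (ord := ord) (σ := σ) (D := D) (δ := δ)
      (x := fun t i j => X t i j ω) hK hσ hc hord
    constructor
    · intro hω
      have hex : ∃ n, t < (run sd c ord σ D δ (fun t i j => X t i j ω) n).played.length :=
        ⟨t + 1, hlen (t + 1)⟩
      classical
      have hspec := Nat.find_spec hex
      have hpos : Nat.find hex ≠ 0 := fun h0 => by
        rw [h0] at hspec
        simp [run] at hspec
      obtain ⟨n, hn⟩ := Nat.exists_eq_succ_of_ne_zero hpos
      refine ⟨n, ?_, ?_, ?_⟩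
      · exact not_lt.1 (Nat.find_min hex (by omega : n < Nat.find hex))
      · rw [hn] at hspec
        exact hspec
      · rw [← hω, actions]
        rw [hn] at hspec
        exact run_take_eq hspec (hlen (t + 1))
    · rintro ⟨n, -, hn, rfl⟩
      exact run_take_eq (hlen (t + 1)) hn
  rw [h1]
  refine MeasurableSet.iUnion fun n => MeasurableSet.iUnion fun u => ?_
  by_cases hu : u.played.length ≤ t
  · exact MeasurableSet.inter (past_mono hu _ (measurableSet_run_eq n u)) (MeasurableSet.const _)
  · simp [hu]

end Adapted

/-! ### Concentration of the empirical means -/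

theorem sum_Icc_telescope (N : ℕ) :
    ∑ n ∈ Finset.Icc 1 N, ((1 : ℝ) / n - 1 / (n + 1 : ℕ)) = 1 - 1 / (N + 1 : ℕ) := by
  induction N with
  | zero => simp
  | succ N ih =>
    rw [Finset.sum_Icc_succ_top (by omega), ih]
    ring

section Concentration

variable {K : ℕ} {sd : Fin K → Fin K → ℝ≥0∞}
  {c : Finset (Fin K) → Finset (Fin K) → Fin K → ℝ} {ord : ℕ → (Fin K → ℕ) → List (Fin K)}
  {σ D δ : ℝ}

/-- The action of round `t` of the history `h`, if it provides one of the first `k` observations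
of `i`. -/
noncomputable def observingAction (sd : Fin K → Fin K → ℝ≥0∞) (i : Fin K) (k t : ℕ) (h : List (Fin K)) :
    Option (Fin K) :=
  h[t]?.bind fun a => if i ∈ obsSet sd a ∧ numObs sd (h.take t) i < k then some a else none

/-- Up to the end of the history fewer than all of its observations of `i` have been made before
each observing round, so none is discarded; beyond it the quota is exhausted and every factor is
trivial. Thus a product over a fixed horizon with a fixed quota `k` represents the product over the
random history on the event that the count equals `k`. -/
theorem prod_observingAction {M : Type*} [CommMonoid M] (hK : 0 < K) (hσ : 0 ≤ σ)
    (hc : IsMaximinRule sd c) (hord : IsPlayOrder ord) (x : ℕ → Fin K → Fin K → ℝ) (n : ℕ)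
    (i : Fin K) {H : ℕ} (hH : (run sd c ord σ D δ x n).played.length ≤ H)
    (w : ℕ → Option (Fin K) → M) (hw : ∀ t, w t none = 1) :
    ∏ t ∈ Finset.range H, w t (observingAction sd i
        (numObs sd (run sd c ord σ D δ x n).played i) t (actions sd c ord σ D δ x (t + 1))) =
      ∏ t ∈ Finset.univ.filter (fun t : Fin (run sd c ord σ D δ x n).played.length =>
          i ∈ obsSet sd ((run sd c ord σ D δ x n).played.get t)),
        w t (some ((run sd c ord σ D δ x n).played.get t)) := by
  set h := (run sd c ord σ D δ x n).played with hh
  rw [← Finset.prod_subset (Finset.range_subset_range.2 hH), Finset.prod_range, Finset.prod_filter]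
  · refine Finset.prod_congr rfl fun t _ => ?_
    have h1 : actions sd c ord σ D δ x (t + 1) = h.take (t + 1) :=
      run_take_eq (le_length_run hK hσ hc hord _) (Nat.succ_le_of_lt t.2)
    rw [observingAction, h1, List.take_take, min_eq_left (Nat.le_succ _)]
    rw [List.getElem?_take_of_lt (Nat.lt_succ_self _), List.getElem?_eq_getElem t.2,
      Option.bind_some, List.get_eq_getElem]
    by_cases hi : i ∈ obsSet sd h[(t : ℕ)]
    · have h2 : numObs sd (h.take t) i < numObs sd h i := by
        have h3 : h = h.take t ++ ([h[(t : ℕ)]] ++ h.drop (t + 1)) := by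
          simp
        conv_rhs => rw [h3]
        rw [numObs_append, numObs_append]
        have h4 : numObs sd [h[(t : ℕ)]] i = 1 := by simp [numObs_eq_sum_map, hi]
        omega
      rw [if_pos ⟨hi, h2⟩, if_pos hi]
    · rw [if_neg fun h5 => hi h5.1, if_neg hi, hw]
  · intro t _ ht
    have ht : h.length ≤ t := by simpa using ht
    have h1 : numObs sd h i ≤ numObs sd ((actions sd c ord σ D δ x (t + 1)).take t) i := by
      have hp := run_played_prefix (sd := sd) (c := c) (ord := ord) (σ := σ) (D := D) (δ := δ)
        (x := x) (le_max_left n (t + 1))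
      have hlen := (le_length_run (sd := sd) (c := c) (ord := ord) (σ := σ) (D := D) (δ := δ)
        (x := x) hK hσ hc hord (max n (t + 1)))
      have h2 : actions sd c ord σ D δ x (t + 1) =
          (run sd c ord σ D δ x (max n (t + 1))).played.take (t + 1) :=
        run_take_eq (le_length_run hK hσ hc hord _) ((le_max_right _ _).trans hlen)
      rw [h2, List.take_take, min_eq_left (Nat.le_succ _)]
      obtain ⟨m, hm⟩ := hp
      rw [← hm, ← hh, List.take_append, List.take_of_length_le ht, numObs_append]
      omega
    have h2 : observingAction sd i (numObs sd h i) t (actions sd c ord σ D δ x (t + 1)) = none := by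
      rw [observingAction]
      cases (actions sd c ord σ D δ x (t + 1))[t]? with
      | none => rfl
      | some a =>
        rw [Option.bind_some, if_neg]
        intro h3
        omega
    rw [h2, hw]

variable {Ω : Type*} {X : ℕ → Fin K → Fin K → Ω → ℝ} {θ : Fin K → ℝ}

/-- The exponential factor contributed by an observation of `i` in round `t`. -/
noncomputable def expFactor (sd : Fin K → Fin K → ℝ≥0∞) (X : ℕ → Fin K → Fin K → Ω → ℝ)
    (θ : Fin K → ℝ) (σ l : ℝ) (i : Fin K) (t : ℕ) (q : Option (Fin K)) (ω : Ω) : ℝ≥0∞ :=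
  q.elim 1 fun a => if i ∈ obsSet sd a then
    ENNReal.ofReal (Real.exp (l * (X t a i ω - θ i) - l ^ 2 * σ ^ 2 / 2)) else 1

theorem prod_expFactor (hK : 0 < K) (hσ : 0 ≤ σ)
    (hc : IsMaximinRule sd c) (hord : IsPlayOrder ord) (l : ℝ) (n : ℕ)
    (i : Fin K) (ω : Ω) {H : ℕ}
    (hH : (run sd c ord σ D δ (fun t i j => X t i j ω) n).played.length ≤ H)
    (hpos : 0 < numObs sd (run sd c ord σ D δ (fun t i j => X t i j ω) n).played i) :
    ∏ t ∈ Finset.range H, expFactor sd X θ σ l i t (observingAction sd i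
        (numObs sd (run sd c ord σ D δ (fun t i j => X t i j ω) n).played i) t
          (actions sd c ord σ D δ (fun t i j => X t i j ω) (t + 1))) ω =
      ENNReal.ofReal (Real.exp
        (numObs sd (run sd c ord σ D δ (fun t i j => X t i j ω) n).played i *
        (l * (empMean sd (fun t i j => X t i j ω)
          (run sd c ord σ D δ (fun t i j => X t i j ω) n).played i - θ i) -
            l ^ 2 * σ ^ 2 / 2))) := by
  rw [prod_observingAction hK hσ hc hord _ n i hH (fun t q => expFactor sd X θ σ l i t q ω)
    fun _ => rfl]
  set h := (run sd c ord σ D δ (fun t i j => X t i j ω) n).played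
  rw [Finset.prod_congr rfl fun (t : Fin h.length) ht => show expFactor sd X θ σ l i t (some (h.get t)) ω =
    ENNReal.ofReal (Real.exp (l * (X t (h.get t) i ω - θ i) - l ^ 2 * σ ^ 2 / 2)) from
      if_pos (Finset.mem_filter.1 ht).2]
  rw [← ENNReal.ofReal_prod_of_nonneg fun _ _ => (Real.exp_pos _).le, ← Real.exp_sum]
  congr 2
  rw [Finset.sum_sub_distrib, ← Finset.mul_sum, Finset.sum_sub_distrib, Finset.sum_const,
    Finset.sum_const]
  have h1 : (Finset.univ.filter fun t : Fin h.length => i ∈ obsSet sd (h.get t)).card =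
    numObs sd h i := rfl
  have h2 : (numObs sd h i : ℝ) ≠ 0 := by exact_mod_cast hpos.ne'
  rw [h1, nsmul_eq_mul, nsmul_eq_mul, empMean]
  field_simp

theorem measurable_expFactor (l : ℝ) (i : Fin K) (t : ℕ) (q : Option (Fin K)) :
    Measurable[roundInfo sd X t] (expFactor sd X θ σ l i t q) := by
  rcases q with _ | a
  · exact @measurable_const _ _ _ (roundInfo sd X t) 1
  · by_cases hi : i ∈ obsSet sd a
    · have h1 := measurable_roundInfo (X := X) t hi
      have h2 : expFactor sd X θ σ l i t (some a) = fun ω =>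
          ENNReal.ofReal (Real.exp (l * (X t a i ω - θ i) - l ^ 2 * σ ^ 2 / 2)) := by
        ext ω
        simp [expFactor, hi]
      rw [h2]
      exact ENNReal.measurable_ofReal.comp
        (Real.measurable_exp.comp (((h1.sub_const _).const_mul _).sub_const _))
    · have h2 : expFactor sd X θ σ l i t (some a) = fun _ => 1 := by
        ext ω
        simp [expFactor, hi]
      rw [h2]
      exact @measurable_const _ _ _ (roundInfo sd X t) 1

variable [MeasurableSpace Ω] {μ : Measure Ω}

theorem sd_eq_of_mem (huniform : ∀ i j, sd i j = ENNReal.ofReal σ ∨ sd i j = ⊤) {i j : Fin K}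
    (h : j ∈ obsSet sd i) : sd i j = ENNReal.ofReal σ := by
  rcases huniform i j with h1 | h1
  · exact h1
  · simp [obsSet, h1] at h

theorem IsEnvironment.law_eq (hX : IsEnvironment μ sd θ X)
    (huniform : ∀ i j, sd i j = ENNReal.ofReal σ ∨ sd i j = ⊤) (t : ℕ) {i j : Fin K}
    (h : j ∈ obsSet sd i) : μ.map (X t i j) = gaussianReal (θ j) (σ.toNNReal ^ 2) := by
  rw [hX.law t i j h, sd_eq_of_mem huniform h]
  rw [ENNReal.toNNReal_pow]
  rfl

variable [IsProbabilityMeasure μ]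

/-- The subtracted term `l² σ² / 2` is the logarithm of the moment generating function of the
centred Gaussian. The factors are trivial for `none` and for actions that do not observe `i`. -/
theorem lintegral_expFactor (hX : IsEnvironment μ sd θ X) (hσ : 0 ≤ σ)
    (huniform : ∀ i j, sd i j = ENNReal.ofReal σ ∨ sd i j = ⊤) (l : ℝ) (i : Fin K) (t : ℕ)
    (q : Option (Fin K)) : ∫⁻ ω, expFactor sd X θ σ l i t q ω ∂μ = 1 := by
  rcases q with _ | a
  · simp [expFactor]
  · by_cases hi : i ∈ obsSet sd a
    · simp only [expFactor, Option.elim_some, if_pos hi]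
      have hm := mgf_gaussianReal (hX.law_eq huniform t hi) l
      have hint : Integrable (fun ω => Real.exp (l * X t a i ω)) μ := by
        rw [← mgf_pos_iff, hm]
        exact Real.exp_pos _
      have heq : ∀ ω, Real.exp (l * (X t a i ω - θ i) - l ^ 2 * σ ^ 2 / 2) =
          Real.exp (l * X t a i ω) * Real.exp (-(l * θ i) - l ^ 2 * σ ^ 2 / 2) := fun ω => by
        rw [← Real.exp_add]
        congr 1
        ring
      simp only [heq]
      rw [← ofReal_integral_eq_lintegral_ofReal (hint.mul_const _)
        (Filter.Eventually.of_forall fun _ => by positivity), integral_mul_const]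
      rw [show ∫ ω, Real.exp (l * X t a i ω) ∂μ = mgf (X t a i) μ l from rfl, hm, ← Real.exp_add]
      rw [← ENNReal.ofReal_one, ← Real.exp_zero]
      congr 2
      rw [NNReal.coe_pow, Real.coe_toNNReal σ hσ]
      ring
    · simp [expFactor, hi]

theorem lintegral_prod_expFactor (hK : 0 < K) (hσ : 0 ≤ σ)
    (hc : IsMaximinRule sd c) (hord : IsPlayOrder ord) (hX : IsEnvironment μ sd θ X)
    (huniform : ∀ i j, sd i j = ENNReal.ofReal σ ∨ sd i j = ⊤) (l : ℝ) (i : Fin K) (k H : ℕ) :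
    Measurable (fun ω => ∏ t ∈ Finset.range H, expFactor sd X θ σ l i t (observingAction sd i k t
      (actions sd c ord σ D δ (fun t i j => X t i j ω) (t + 1))) ω) ∧
    ∫⁻ ω, ∏ t ∈ Finset.range H, expFactor sd X θ σ l i t (observingAction sd i k t
      (actions sd c ord σ D δ (fun t i j => X t i j ω) (t + 1))) ω ∂μ = 1 := by
  have h := lintegral_prod_predictable (F := past sd X) (G := roundInfo sd X)
    (fun t => hX.past_le t) (fun t => hX.roundInfo_le t) (fun t => past_mono (Nat.le_succ t))
    (fun t => roundInfo_le_past (Nat.lt_succ_self t)) (fun t => hX.indep_past t)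
    (Q := fun t ω => observingAction sd i k t
      (actions sd c ord σ D δ (fun t i j => X t i j ω) (t + 1)))
    (fun t q => ?_) (V := expFactor sd X θ σ l i) (fun t q => measurable_expFactor l i t q)
    (fun t q => lintegral_expFactor hX hσ huniform l i t q) H
  · exact ⟨h.1.mono (hX.past_le H) le_rfl, h.2⟩
  · have h1 : {ω | observingAction sd i k t
        (actions sd c ord σ D δ (fun t i j => X t i j ω) (t + 1)) = q} =
        ⋃ h : List (Fin K), {ω | actions sd c ord σ D δ (fun t i j => X t i j ω) (t + 1) = h} ∩
          {_ω | observingAction sd i k t h = q} := by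
      ext ω
      simp
    rw [h1]
    exact MeasurableSet.iUnion fun h =>
      (measurableSet_actions_eq hK hσ hc hord t h).inter (MeasurableSet.const _)

/-- Markov's inequality for the product of mean one, with horizon `2Kn`, which exceeds the length of
any history of `n` phases. -/
theorem measure_exp_tail_le (hK : 0 < K) (hσ : 0 ≤ σ)
    (hc : IsMaximinRule sd c) (hord : IsPlayOrder ord) (hX : IsEnvironment μ sd θ X)
    (huniform : ∀ i j, sd i j = ENNReal.ofReal σ ∨ sd i j = ⊤) (l L : ℝ) (i : Fin K) (n : ℕ)
    {k : ℕ} (hk : 0 < k) :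
    μ {ω | numObs sd (run sd c ord σ D δ (fun t i j => X t i j ω) n).played i = k ∧
      L ≤ k * (l * (empMean sd (fun t i j => X t i j ω)
          (run sd c ord σ D δ (fun t i j => X t i j ω) n).played i - θ i) -
            l ^ 2 * σ ^ 2 / 2)} ≤ ENNReal.ofReal (Real.exp (-L)) := by
  obtain ⟨hm, hi⟩ := lintegral_prod_expFactor (D := D) (δ := δ) hK hσ hc hord hX huniform l i k
    (2 * K * n)
  have h1 := meas_ge_le_lintegral_div hm.aemeasurable (μ := μ)
    (ε := ENNReal.ofReal (Real.exp L)) (by simp [Real.exp_pos]) ENNReal.ofReal_ne_top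
  rw [hi] at h1
  refine (measure_mono ?_).trans (h1.trans (le_of_eq ?_))
  · rintro ω ⟨h2, h3⟩
    rw [Set.mem_ofPred_eq]
    have h4 := prod_expFactor (θ := θ) hK hσ hc hord l n i ω
      (length_run_le (sd := sd) (c := c) (ord := ord) (σ := σ) (D := D) (δ := δ)
        (x := fun t i j => X t i j ω) hK hσ hc hord n) (by omega)
    rw [h2] at h4
    rw [h4]
    exact ENNReal.ofReal_le_ofReal (Real.exp_le_exp.2 h3)
  · rw [one_div, Real.exp_neg, ENNReal.ofReal_inv_of_pos (Real.exp_pos _)]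

/-- The Chernoff bound, with the optimal exponents `l = ± s / σ`, where `s = √(2L/k)`; for these the
exponent at the boundary is exactly `L`. -/
theorem measure_tail_le (hK : 0 < K) (hσ : 0 < σ)
    (hc : IsMaximinRule sd c) (hord : IsPlayOrder ord) (hX : IsEnvironment μ sd θ X)
    (huniform : ∀ i j, sd i j = ENNReal.ofReal σ ∨ sd i j = ⊤) {L : ℝ} (hL : 0 ≤ L) (i : Fin K)
    (n : ℕ) {k : ℕ} (hk : 0 < k) :
    μ {ω | numObs sd (run sd c ord σ D δ (fun t i j => X t i j ω) n).played i = k ∧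
      σ * Real.sqrt (2 * L / k) < |empMean sd (fun t i j => X t i j ω)
          (run sd c ord σ D δ (fun t i j => X t i j ω) n).played i - θ i|} ≤
      2 * ENNReal.ofReal (Real.exp (-L)) := by
  have hk' : (0 : ℝ) < k := by exact_mod_cast hk
  set s := Real.sqrt (2 * L / k) with hs
  have hs0 : 0 ≤ s := Real.sqrt_nonneg _
  have hs2 : s ^ 2 = 2 * L / k := Real.sq_sqrt (by positivity)
  have hks : (k : ℝ) * s ^ 2 = 2 * L := by rw [hs2]; field_simp
  have h1 := measure_exp_tail_le (D := D) (δ := δ) hK hσ.le hc hord hX huniform (s / σ) L i n hk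
  have h2 := measure_exp_tail_le (D := D) (δ := δ) hK hσ.le hc hord hX huniform (-(s / σ)) L i n hk
  rw [two_mul]
  refine le_trans (measure_mono ?_) ((measure_union_le _ _).trans (add_le_add h1 h2))
  have key : ∀ y : ℝ, σ * s < y → L ≤ k * (s / σ * y - (s / σ) ^ 2 * σ ^ 2 / 2) := by
    intro y hy
    have h3 : (s / σ) ^ 2 * σ ^ 2 = s ^ 2 := by field_simp
    have h4 : s ^ 2 ≤ s / σ * y := by
      have h5 : s / σ * (σ * s) ≤ s / σ * y := mul_le_mul_of_nonneg_left hy.le (by positivity)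
      have h6 : s / σ * (σ * s) = s ^ 2 := by field_simp
      linarith
    rw [h3]
    have h7 := mul_le_mul_of_nonneg_left h4 hk'.le
    rw [mul_sub]
    linarith
  rintro ω ⟨hn, hω⟩
  rcases lt_abs.1 hω with h | h
  · exact Or.inl ⟨hn, key _ h⟩
  · refine Or.inr ⟨hn, (key _ h).trans (le_of_eq ?_)⟩
    ring

/-- All confidence intervals of the phases `2, …, N + 1` hold. -/
def GoodEvent (sd : Fin K → Fin K → ℝ≥0∞)
    (c : Finset (Fin K) → Finset (Fin K) → Fin K → ℝ) (ord : ℕ → (Fin K → ℕ) → List (Fin K))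
    (σ D δ : ℝ) (θ : Fin K → ℝ) (N : ℕ) (x : ℕ → Fin K → Fin K → ℝ) : Prop :=
  ∀ n ∈ Finset.Icc 1 N, ∀ i,
    |empMean sd x (run sd c ord σ D δ x n).played i - θ i| ≤
      confRadius sd σ δ (run sd c ord σ D δ x n).played (n + 1) i

/-- The count is random, so the tail bound is summed over all values from `1` to `2Kn`. The lower
end uses that every action has been observed after the first phase. The bound is written as a
difference in order to telescope over the phases. -/
theorem measure_radius_lt_le (hK : 1 < K) (hσ : 0 < σ) (hδ0 : 0 < δ) (hδ1 : δ < 1)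
    (hc : IsMaximinRule sd c) (hord : IsPlayOrder ord) (hcov : ∀ j, ∃ i, j ∈ obsSet sd i)
    (hX : IsEnvironment μ sd θ X)
    (huniform : ∀ i j, sd i j = ENNReal.ofReal σ ∨ sd i j = ⊤) (i : Fin K)
    {n : ℕ} (hn : 1 ≤ n) :
    μ {ω | confRadius sd σ δ (run sd c ord σ D δ (fun t i j => X t i j ω) n).played (n + 1) i <
      |empMean sd (fun t i j => X t i j ω)
          (run sd c ord σ D δ (fun t i j => X t i j ω) n).played i - θ i|} ≤
      ENNReal.ofReal (δ / K * (1 / n - 1 / (n + 1 : ℕ))) := by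
  have hK0 : 0 < K := by omega
  have hKr : (1 : ℝ) ≤ K := by exact_mod_cast hK0
  have hnr : (1 : ℝ) ≤ n := by exact_mod_cast hn
  set y := 8 * (K : ℝ) ^ 2 * ((n + 1 : ℕ) : ℝ) ^ 3 / δ with hy
  have hy1 : 1 ≤ y := by
    rw [hy, le_div_iff₀ hδ0]
    have h1 : (1 : ℝ) ≤ (K : ℝ) ^ 2 := one_le_pow₀ hKr
    have h2 : (1 : ℝ) ≤ ((n + 1 : ℕ) : ℝ) ^ 3 := one_le_pow₀ (by push_cast; linarith)
    nlinarith
  have hsub : {ω | confRadius sd σ δ (run sd c ord σ D δ (fun t i j => X t i j ω) n).played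
        (n + 1) i < |empMean sd (fun t i j => X t i j ω)
          (run sd c ord σ D δ (fun t i j => X t i j ω) n).played i - θ i|} ⊆
      ⋃ k ∈ Finset.Icc 1 (2 * K * n),
        {ω | numObs sd (run sd c ord σ D δ (fun t i j => X t i j ω) n).played i = k ∧
          σ * Real.sqrt (2 * Real.log y / k) < |empMean sd (fun t i j => X t i j ω)
          (run sd c ord σ D δ (fun t i j => X t i j ω) n).played i - θ i|} := by
    intro ω hω
    simp only [Set.mem_iUnion]
    refine ⟨numObs sd (run sd c ord σ D δ (fun t i j => X t i j ω) n).played i, ?_, rfl, hω⟩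
    rw [Finset.mem_Icc]
    exact ⟨numObs_run_pos hK hc hord hcov hn i,
      (numObs_le_length _ _ _).trans (length_run_le hK0 hσ.le hc hord n)⟩
  refine (measure_mono hsub).trans ((measure_biUnion_finset_le _ _).trans ?_)
  refine (Finset.sum_le_sum fun k hk => measure_tail_le (D := D) (δ := δ) hK0 hσ hc hord hX huniform
    (Real.log_nonneg hy1) i n (Finset.mem_Icc.1 hk).1).trans ?_
  rw [Finset.sum_const, Nat.card_Icc, Real.exp_neg, Real.exp_log (by linarith), nsmul_eq_mul]
  rw [← ENNReal.ofReal_natCast, ← ENNReal.ofReal_ofNat 2, ← ENNReal.ofReal_mul (by norm_num),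
    ← ENNReal.ofReal_mul (Nat.cast_nonneg _)]
  refine ENNReal.ofReal_le_ofReal ?_
  rw [hy, Nat.add_sub_cancel, inv_div]
  push_cast
  -- The factors `8`, `K²` and `r³` of the radius are used here: `2Kn` values with two tails each
  -- still leave a summable term and a factor `1 / K` for the union over actions.
  have h3 : 2 * (K : ℝ) * n * (2 * (δ / (8 * (K : ℝ) ^ 2 * ((n : ℝ) + 1) ^ 3))) =
      δ / K * (n / (2 * ((n : ℝ) + 1) ^ 3)) := by
    field_simp
    norm_num
  have h4 : (1 : ℝ) / n - 1 / ((n : ℝ) + 1) = 1 / (n * (n + 1)) := by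
    field_simp
    ring
  rw [h3, h4]
  refine mul_le_mul_of_nonneg_left ?_ (by positivity)
  rw [div_le_div_iff₀ (by positivity) (by positivity)]
  nlinarith [sq_nonneg ((n : ℝ) + 1), pow_pos (by linarith : (0 : ℝ) < n) 3]

/-- Union bound over actions and phases. The case `σ = 0` is separate because the Chernoff exponent
divides by `σ`. -/
theorem measure_not_goodEvent_le (hK : 1 < K) (hσ : 0 ≤ σ) (hδ0 : 0 < δ) (hδ1 : δ < 1)
    (hc : IsMaximinRule sd c) (hord : IsPlayOrder ord) (hcov : ∀ j, ∃ i, j ∈ obsSet sd i)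
    (hX : IsEnvironment μ sd θ X)
    (huniform : ∀ i j, sd i j = ENNReal.ofReal σ ∨ sd i j = ⊤) (N : ℕ) :
    μ {ω | ¬ GoodEvent sd c ord σ D δ θ N (fun t i j => X t i j ω)} ≤ ENNReal.ofReal δ := by
  rcases hσ.eq_or_lt with rfl | hσ
  · -- Without noise all observations are exact.
    have h1 : ∀ᵐ ω ∂μ, ∀ t i, ∀ j ∈ obsSet sd i, X t i j ω = θ j := by
      rw [ae_all_iff]; intro t
      rw [ae_all_iff]; intro i
      rw [ae_all_iff]; intro j
      by_cases hj : j ∈ obsSet sd i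
      · have h2 := hX.law_eq huniform t hj
        rw [Real.toNNReal_zero, zero_pow two_ne_zero, gaussianReal_zero_var] at h2
        have h4 : ∀ᵐ y ∂(μ.map (X t i j)), y = θ j := by
          rw [h2, ae_dirac_eq]
          exact rfl
        filter_upwards [ae_of_ae_map (hX.measurable t i j hj).aemeasurable h4] with ω hω _
        exact hω
      · exact Filter.Eventually.of_forall fun ω h => absurd h hj
    have h2 : ∀ᵐ ω ∂μ, GoodEvent sd c ord 0 D δ θ N (fun t i j => X t i j ω) := by
      filter_upwards [h1] with ω hω n hn i
      have hpos := numObs_run_pos (σ := 0) (D := D) (δ := δ) (x := fun t i j => X t i j ω) hK hc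
        hord hcov (Finset.mem_Icc.1 hn).1 i
      have hpos' : (numObs sd (run sd c ord 0 D δ (fun t i j => X t i j ω) n).played i : ℝ) ≠ 0 :=
        by exact_mod_cast hpos.ne'
      rw [empMean, Finset.sum_congr rfl fun t ht => hω _ _ _ (Finset.mem_filter.1 ht).2,
        Finset.sum_const, nsmul_eq_mul]
      rw [show (Finset.univ.filter fun t : Fin (run sd c ord 0 D δ (fun t i j => X t i j ω)
        n).played.length => i ∈ obsSet sd ((run sd c ord 0 D δ (fun t i j => X t i j ω)
        n).played.get t)).card = numObs sd (run sd c ord 0 D δ (fun t i j => X t i j ω) n).played i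
        from rfl, mul_div_cancel_left₀ _ hpos', sub_self, abs_zero]
      exact confRadius_nonneg le_rfl _ _ _
    rw [ae_iff] at h2
    rw [h2]
    simp
  · have hK0 : (0 : ℝ) < K := by exact_mod_cast (by omega : 0 < K)
    have hsub : {ω | ¬ GoodEvent sd c ord σ D δ θ N (fun t i j => X t i j ω)} ⊆
        ⋃ n ∈ Finset.Icc 1 N, ⋃ i ∈ (Finset.univ : Finset (Fin K)),
          {ω | confRadius sd σ δ (run sd c ord σ D δ (fun t i j => X t i j ω) n).played (n + 1) i <
      |empMean sd (fun t i j => X t i j ω)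
          (run sd c ord σ D δ (fun t i j => X t i j ω) n).played i - θ i|} := by
      intro ω hω
      simp only [GoodEvent, Set.mem_ofPred_eq, not_forall, not_le] at hω
      obtain ⟨n, hn, i, hi⟩ := hω
      simp only [Set.mem_iUnion]
      exact ⟨n, hn, i, Finset.mem_univ i, hi⟩
    refine (measure_mono hsub).trans ((measure_biUnion_finset_le _ _).trans ?_)
    have h1 : ∀ n ∈ Finset.Icc 1 N, μ (⋃ i ∈ (Finset.univ : Finset (Fin K)),
          {ω | confRadius sd σ δ (run sd c ord σ D δ (fun t i j => X t i j ω) n).played (n + 1) i <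
      |empMean sd (fun t i j => X t i j ω)
          (run sd c ord σ D δ (fun t i j => X t i j ω) n).played i - θ i|}) ≤
          ENNReal.ofReal (δ * (1 / n - 1 / (n + 1 : ℕ))) := by
      intro n hn
      refine (measure_biUnion_finset_le _ _).trans ((Finset.sum_le_sum fun i _ =>
        measure_radius_lt_le hK hσ hδ0 hδ1 hc hord hcov hX huniform i
          (Finset.mem_Icc.1 hn).1).trans (le_of_eq ?_))
      rw [Finset.sum_const, Finset.card_univ, Fintype.card_fin, nsmul_eq_mul,
        ← ENNReal.ofReal_natCast, ← ENNReal.ofReal_mul (Nat.cast_nonneg _)]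
      congr 1
      field_simp
    refine (Finset.sum_le_sum h1).trans ?_
    rw [← ENNReal.ofReal_sum_of_nonneg, ← Finset.mul_sum]
    · refine ENNReal.ofReal_le_ofReal ?_
      rw [sum_Icc_telescope]
      have h3 : (0 : ℝ) ≤ 1 / (N + 1 : ℕ) := by positivity
      nlinarith
    · intro n hn
      have h2 : (1 : ℝ) ≤ n := by exact_mod_cast (Finset.mem_Icc.1 hn).1
      have h3 : (1 : ℝ) / (n + 1 : ℕ) ≤ 1 / n := by
        push_cast
        exact one_div_le_one_div_of_le (by linarith) (by linarith)
      exact mul_nonneg hδ0.le (by linarith)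

end Concentration

/-! ### Gaps and elimination -/

section Regret

variable {K : ℕ} {θ : Fin K → ℝ}

theorem exists_best (hK : 0 < K) (θ : Fin K → ℝ) :
    ∃ b, (∀ i, θ i ≤ θ b) ∧ ∀ i, gap θ i = θ b - θ i := by
  have : Nonempty (Fin K) := ⟨⟨0, hK⟩⟩
  obtain ⟨b, hb⟩ := Finite.exists_max θ
  refine ⟨b, hb, fun i => ?_⟩
  rw [gap, le_antisymm (ciSup_le hb) (le_ciSup (Set.finite_range θ).bddAbove b)]

theorem gap_le (hK : 0 < K) {D : ℝ} (hθ : ∀ i, θ i ∈ Set.Icc 0 D) (i : Fin K) : gap θ i ≤ D := by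
  obtain ⟨b, -, hg⟩ := exists_best hK θ
  rw [hg i]
  linarith [(hθ i).1, (hθ b).2]

variable {sd : Fin K → Fin K → ℝ≥0∞}
  {c : Finset (Fin K) → Finset (Fin K) → Fin K → ℝ} {ord : ℕ → (Fin K → ℕ) → List (Fin K)}
  {σ D δ : ℝ} {x : ℕ → Fin K → Fin K → ℝ}

theorem best_mem_active {N : ℕ} (hgood : GoodEvent sd c ord σ D δ θ N x) {b : Fin K}
    (hb : ∀ i, θ i ≤ θ b) {n : ℕ} (hn : n ≤ N) : b ∈ (run sd c ord σ D δ x n).active := by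
  induction n with
  | zero => exact Finset.mem_univ _
  | succ n ih =>
    by_cases h : (run sd c ord σ D δ x n).active.card = 1
    · rw [run_succ, phaseStep_of_card_eq_one h]
      exact ih (by omega)
    · rw [run_succ_active h]
      refine mem_survivors.2 ⟨ih (by omega), fun j _ => ?_⟩
      have h1 := abs_le.1 (hgood (n + 1) (Finset.mem_Icc.2 ⟨by omega, hn⟩) j)
      have h2 := abs_le.1 (hgood (n + 1) (Finset.mem_Icc.2 ⟨by omega, hn⟩) b)
      linarith [hb j, h1.2, h2.1]

/-- Survival of `i` against a best action costs one radius for each of the two confidence intervals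
and one for each of the two deviations of the means, hence the factor `4`. The radii are those of
the elimination that ended the previous phase. -/
theorem gap_le_of_active (hK : 0 < K) (hσ : 0 ≤ σ) (hδ0 : 0 < δ) (hδ1 : δ < 1) {T : ℕ}
    (hgood : GoodEvent sd c ord σ D δ θ T x) {n : ℕ} (hn1 : 1 ≤ n) (hnT : n < T)
    (hcard : (run sd c ord σ D δ x n).active.card ≠ 1) {M : ℝ} (hM : 0 < M)
    (hMn : ∀ j ∈ (run sd c ord σ D δ x n).active,
      M ≤ numObs sd (run sd c ord σ D δ x n).played j) {i : Fin K}
    (hi : i ∈ (run sd c ord σ D δ x n).active) :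
    gap θ i ≤ 4 * σ * Real.sqrt (6 * Real.log (2 * K * T / δ) / M) := by
  obtain ⟨b, hb, hg⟩ := exists_best hK θ
  have hba := best_mem_active hgood hb hnT.le
  have hrad : ∀ j ∈ (run sd c ord σ D δ x n).active,
      confRadius sd σ δ (run sd c ord σ D δ x n).played (n + 1) j ≤
        σ * Real.sqrt (6 * Real.log (2 * K * T / δ) / M) := by
    intro j hj
    have hKr : (1 : ℝ) ≤ K := by exact_mod_cast hK
    have hTr : (n : ℝ) + 1 ≤ T := by exact_mod_cast hnT
    have hn0 : (0 : ℝ) ≤ n := Nat.cast_nonneg _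
    have hlog : 2 * Real.log (8 * (K : ℝ) ^ 2 * ((n + 1 : ℕ) : ℝ) ^ 3 / δ) ≤
        6 * Real.log (2 * K * T / δ) := by
      -- The exponent of `r` makes the argument of the logarithm at most a cube, since `n + 1 ≤ T`,
      -- `K ≥ 1` and `δ ≤ 1`; this gives the constant `6` and the single logarithm `log (2KT/δ)`.
      have h1 : 8 * (K : ℝ) ^ 2 * ((n + 1 : ℕ) : ℝ) ^ 3 / δ ≤ (2 * K * T / δ) ^ 3 := by
        push_cast
        rw [div_pow, div_le_div_iff₀ hδ0 (by positivity)]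
        have h2 : (K : ℝ) ^ 2 ≤ (K : ℝ) ^ 3 := pow_le_pow_right₀ hKr (by norm_num)
        have h3 : ((n : ℝ) + 1) ^ 3 ≤ (T : ℝ) ^ 3 := pow_le_pow_left₀ (by linarith) hTr 3
        have h4 : δ ^ 3 ≤ δ := by
          calc δ ^ 3 ≤ δ ^ 1 := pow_le_pow_of_le_one hδ0.le hδ1.le (by norm_num)
            _ = δ := pow_one δ
        calc 8 * (K : ℝ) ^ 2 * ((n : ℝ) + 1) ^ 3 * δ ^ 3
            ≤ 8 * (K : ℝ) ^ 3 * (T : ℝ) ^ 3 * δ := by gcongr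
          _ = (2 * K * T) ^ 3 * δ := by ring
      have h2 := Real.log_le_log (by positivity) h1
      rw [Real.log_pow] at h2
      push_cast at h2 ⊢
      linarith
    have hlog0 : 0 ≤ Real.log (8 * (K : ℝ) ^ 2 * ((n + 1 : ℕ) : ℝ) ^ 3 / δ) := by
      refine Real.log_nonneg ?_
      push_cast
      rw [le_div_iff₀ hδ0]
      have h1 : (1 : ℝ) ≤ (K : ℝ) ^ 2 := one_le_pow₀ hKr
      have h2 : (1 : ℝ) ≤ ((n : ℝ) + 1) ^ 3 := one_le_pow₀ (by linarith)
      nlinarith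
    rw [confRadius]
    refine mul_le_mul_of_nonneg_left (Real.sqrt_le_sqrt ?_) hσ
    exact div_le_div₀ (by linarith) hlog hM (hMn j hj)
  obtain ⟨m, rfl⟩ := Nat.exists_eq_add_of_le' hn1
  have h1 := run_card_ne_one_of_succ hcard
  have hi' := hi
  rw [run_succ_active h1] at hi'
  have h2 := (mem_survivors.1 hi').2 b (run_succ_active_subset m hba)
  have h3 := abs_le.1 (hgood (m + 1) (Finset.mem_Icc.2 ⟨by omega, hnT.le⟩) i)
  have h4 := abs_le.1 (hgood (m + 1) (Finset.mem_Icc.2 ⟨by omega, hnT.le⟩) b)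
  rw [hg i]
  linarith [hrad i hi, hrad b hba, h3.1, h3.2, h4.1, h4.2]

/-! ### Decomposition of the regret over rounds -/

theorem sum_map_le_sum_range {α : Type*} (g : α → ℝ) (f : ℕ → ℝ) (l : List α)
    (h : ∀ a ∈ l, ∀ t < l.length, g a ≤ f t) :
    (l.map g).sum ≤ ∑ t ∈ Finset.range l.length, f t := by
  induction l generalizing f with
  | nil => simp
  | cons a l ih =>
    rw [List.map_cons, List.sum_cons, List.length_cons, Finset.sum_range_succ', add_comm]
    exact add_le_add (ih (fun t => f (t + 1)) fun b hb t ht =>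
      h b (List.mem_cons_of_mem _ hb) (t + 1) (by simpa using ht))
      (h a List.mem_cons_self 0 (by simp))

/-- Phase by phase: weak exploration is charged `D` per round, other exploration is charged `f`, and
a single remaining action is a best one and costs nothing. A phase that is cut off at `T` is still
charged in full in `weakRounds`. -/
theorem sum_map_take_le (hK : 0 < K) (hσ : 0 ≤ σ) (hD : 0 < D) (hc : IsMaximinRule sd c)
    (hord : IsPlayOrder ord) (hθ : ∀ i, θ i ∈ Set.Icc 0 D) {T : ℕ}
    (hgood : GoodEvent sd c ord σ D δ θ T x) {f : ℕ → ℝ} (hf0 : ∀ t, 0 ≤ f t)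
    (hf : ∀ n, (run sd c ord σ D δ x n).played.length < T →
      (run sd c ord σ D δ x n).active.card ≠ 1 →
      ¬ ExploreWeak sd c σ D (run sd c ord σ D δ x n) →
      ∀ i ∈ (run sd c ord σ D δ x n).active, ∀ t, (run sd c ord σ D δ x n).played.length ≤ t →
        t < (run sd c ord σ D δ x n).played.length + 2 * K → gap θ i ≤ f t) (n : ℕ)
    (hn : ∀ m < n, (run sd c ord σ D δ x m).played.length < T) :
    (((run sd c ord σ D δ x n).played.take T).map (gap θ)).sum ≤
      D * weakRounds sd c ord σ D δ x n +
        ∑ t ∈ Finset.range ((run sd c ord σ D δ x n).played.take T).length, f t := by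
  induction n with
  | zero => simp [run, weakRounds]
  | succ n ih =>
    have ih := ih fun m hm => hn m (by omega)
    have hlt := hn n (Nat.lt_succ_self n)
    have hnT : n ≤ T := (le_length_run hK hσ hc hord n).trans hlt.le
    have hne := run_active_nonempty (sd := sd) (c := c) (ord := ord) (D := D) (δ := δ) (x := x)
      hK hσ n
    rw [List.take_of_length_le hlt.le] at ih
    rw [run_succ_played, List.take_append, List.take_of_length_le hlt.le, List.map_append,
      List.sum_append, List.length_append, Finset.sum_range_add]
    set l := (phaseList sd c ord σ D (n + 1) (run sd c ord σ D δ x n)).take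
      (T - (run sd c ord σ D δ x n).played.length) with hl
    have hll : l.length ≤ (phaseList sd c ord σ D (n + 1) (run sd c ord σ D δ x n)).length :=
      List.length_take_le' _ _
    have hfs : 0 ≤ ∑ t ∈ Finset.range l.length,
        f ((run sd c ord σ D δ x n).played.length + t) := Finset.sum_nonneg fun t _ => hf0 _
    by_cases h1 : (run sd c ord σ D δ x n).active.card = 1
    · rw [weakRounds_succ_of_not fun h => h.1 h1]
      obtain ⟨b, hb, hg⟩ := exists_best hK θ
      obtain ⟨b', hb'⟩ := Finset.card_eq_one.1 h1
      have hbb : b = b' := by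
        have := best_mem_active hgood hb hnT
        rw [hb'] at this
        exact Finset.mem_singleton.1 this
      -- The best action is active on the good event, so the only active action has gap zero.
      have hz : (l.map (gap θ)).sum = 0 := by
        refine List.sum_eq_zero fun y hy => ?_
        obtain ⟨a, ha, rfl⟩ := List.mem_map.1 hy
        have ha' := List.mem_of_mem_take ha
        rw [phaseList, if_pos h1, hb', Finset.toList_singleton, List.mem_singleton] at ha'
        rw [ha', ← hbb, hg, sub_self]
      rw [hz]
      linarith
    · by_cases hE : ExploreWeak sd c σ D (run sd c ord σ D δ x n)
      · rw [weakRounds_succ_of_explore h1 hE]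
        have hs : (l.map (gap θ)).sum ≤ ∑ t ∈ Finset.range l.length, D :=
          sum_map_le_sum_range _ _ _ fun a _ t _ => gap_le hK hθ a
        rw [Finset.sum_const, Finset.card_range, nsmul_eq_mul] at hs
        have hll' : (l.length : ℝ) ≤
            (phaseList sd c ord σ D (n + 1) (run sd c ord σ D δ x n)).length := by
          exact_mod_cast hll
        have := mul_le_mul_of_nonneg_left hll' hD.le
        push_cast
        linarith
      · rw [weakRounds_succ_of_not fun h => hE h.2]
        have hs := sum_map_le_sum_range (gap θ)
          (fun t => f ((run sd c ord σ D δ x n).played.length + t)) l fun a ha t ht => by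
            refine hf n hlt h1 hE a ?_ _ (Nat.le_add_right _ _) ?_
            · by_contra hna
              have ha' := List.mem_of_mem_take ha
              rw [phaseList, if_neg h1, ← List.count_pos_iff, hord,
                playCounts_eq_zero ((phaseVector_mem hc hne).2 hE) hna] at ha'
              exact lt_irrefl _ ha'
            · have := length_phaseList_le' (σ := σ) (D := D) (r := n + 1) hK hc hord hne
              omega
        linarith

theorem regret_eq_sum_map (T : ℕ) : regret sd c ord σ D δ x θ T =
    ((actions sd c ord σ D δ x T).map (gap θ)).sum :=
  sum_count_mul_eq_sum_map _ _

/-- If the actions played in the phases exploring with the active set have gap at most `f t` in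
round `t`, then the regret is at most the sum of `f` plus the cost of exploring with all actions. -/
theorem exists_regret_le (hK : 0 < K) (hσ : 0 ≤ σ) (hD : 0 < D) (hc : IsMaximinRule sd c)
    (hord : IsPlayOrder ord) (hθ : ∀ i, θ i ∈ Set.Icc 0 D) {T : ℕ} (hT : 0 < T)
    (hgood : GoodEvent sd c ord σ D δ θ T x) {f : ℕ → ℝ} (hf0 : ∀ t, 0 ≤ f t)
    (hf : ∀ n, (run sd c ord σ D δ x n).played.length < T →
      (run sd c ord σ D δ x n).active.card ≠ 1 →
      ¬ ExploreWeak sd c σ D (run sd c ord σ D δ x n) →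
      ∀ i ∈ (run sd c ord σ D δ x n).active, ∀ t, (run sd c ord σ D δ x n).played.length ≤ t →
        t < (run sd c ord σ D δ x n).played.length + 2 * K → gap θ i ≤ f t) :
    ∃ n, (run sd c ord σ D δ x n).played.length < T ∧
      regret sd c ord σ D δ x θ T ≤
        D * weakRounds sd c ord σ D δ x (n + 1) + ∑ t ∈ Finset.range T, f t := by
  classical
  have hlen := le_length_run (sd := sd) (c := c) (ord := ord) (σ := σ) (D := D) (δ := δ)
      (x := x) hK hσ hc hord
  have hex : ∃ n, T ≤ (run sd c ord σ D δ x n).played.length := ⟨T, hlen T⟩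
  have hspec := Nat.find_spec hex
  have hpos : Nat.find hex ≠ 0 := fun h0 => by
    rw [h0] at hspec
    simp [run] at hspec
    omega
  obtain ⟨n, hn⟩ := Nat.exists_eq_succ_of_ne_zero hpos
  rw [hn] at hspec
  have hmin : ∀ m < n + 1, (run sd c ord σ D δ x m).played.length < T := fun m hm =>
    not_le.1 (Nat.find_min hex (by omega))
  refine ⟨n, hmin n (Nat.lt_succ_self n), ?_⟩
  have h1 := sum_map_take_le hK hσ hD hc hord hθ hgood hf0 hf (n + 1) hmin
  rw [List.length_take, min_eq_left hspec, ← run_take_eq (hlen T) hspec] at h1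
  rw [regret_eq_sum_map]
  exact h1

/-! ### Sums of powers -/

/-- Comparison with an integral, in discrete form: Bernoulli's inequality for the concave power `1 -
p` bounds each term by an increment of the right-hand side. -/
theorem sum_range_rpow_neg_le {p : ℝ} (hp0 : 0 ≤ p) (hp1 : p < 1) (n : ℕ) :
    ∑ s ∈ Finset.range n, ((s : ℝ) + 1) ^ (-p) ≤ (n : ℝ) ^ (1 - p) / (1 - p) := by
  have hq : 0 < 1 - p := by linarith
  induction n with
  | zero => simp [Real.zero_rpow hq.ne']
  | succ n ih =>
    rw [Finset.sum_range_succ]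
    refine (add_le_add ih le_rfl).trans ?_
    have hn : (0 : ℝ) < (n : ℝ) + 1 := by positivity
    have h1 := rpow_one_add_le_one_add_mul_self (s := -1 / ((n : ℝ) + 1)) (p := 1 - p)
      (by rw [le_div_iff₀ hn]; linarith [(Nat.cast_nonneg n : (0 : ℝ) ≤ n)]) hq.le (by linarith)
    have h2 : (1 : ℝ) + -1 / ((n : ℝ) + 1) = n / (n + 1) := by field_simp; ring
    rw [h2, Real.div_rpow (Nat.cast_nonneg n) hn.le, div_le_iff₀ (Real.rpow_pos_of_pos hn _)] at h1
    have h3 : ((n : ℝ) + 1) ^ (1 - p) = ((n : ℝ) + 1) ^ (-p) * ((n : ℝ) + 1) := by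
      rw [← Real.rpow_add_one hn.ne']; congr 1; ring
    have h4 : (1 + (1 - p) * (-1 / ((n : ℝ) + 1))) * ((n : ℝ) + 1) ^ (1 - p) =
        ((n : ℝ) + 1) ^ (1 - p) - (1 - p) * ((n : ℝ) + 1) ^ (-p) := by
      rw [h3]; field_simp; ring
    rw [h4] at h1
    push_cast
    rw [le_div_iff₀ hq, add_mul, div_mul_cancel₀ _ hq.ne']
    linarith

/-- The shift by `m` allows for a gap bound known only at the start of a phase, when a round may lie
up to `m` rounds later. -/
theorem sum_range_ite_le {D C p : ℝ} (hD : 0 ≤ D) (hC : 0 ≤ C) (hp0 : 0 ≤ p) (hp1 : p < 1)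
    {B m : ℕ} (hmB : m ≤ B) (T : ℕ) :
    ∑ t ∈ Finset.range T, (if t < B then D else C * ((t : ℝ) + 1 - m) ^ (-p)) ≤
      B * D + C * ((T : ℝ) ^ (1 - p) / (1 - p)) := by
  have h1 : ∀ t ∈ Finset.range T, (if t < B then D else C * ((t : ℝ) + 1 - m) ^ (-p)) ≤
      (if t < B then D else 0) + (if m ≤ t then C * (((t - m : ℕ) : ℝ) + 1) ^ (-p) else 0) := by
    intro t _
    by_cases h : t < B
    · rw [if_pos h, if_pos h]
      have : 0 ≤ (if m ≤ t then C * (((t - m : ℕ) : ℝ) + 1) ^ (-p) else 0) := by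
        split_ifs <;> positivity
      linarith
    · have hm : m ≤ t := by omega
      rw [if_neg h, if_neg h, if_pos hm, Nat.cast_sub hm, zero_add]
      exact le_of_eq (by congr 2; ring)
  refine (Finset.sum_le_sum h1).trans ?_
  rw [Finset.sum_add_distrib]
  refine add_le_add ?_ ?_
  · rw [← Finset.sum_filter, Finset.sum_const, nsmul_eq_mul]
    refine mul_le_mul_of_nonneg_right ?_ hD
    have : (Finset.range T).filter (fun t => t < B) ⊆ Finset.range B := fun t ht => by
      simpa using (Finset.mem_filter.1 ht).2
    exact_mod_cast (Finset.card_le_card this).trans (by simp)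
  · refine le_trans ?_ (mul_le_mul_of_nonneg_left (sum_range_rpow_neg_le hp0 hp1 T) hC)
    rw [← Finset.sum_filter, Finset.mul_sum]
    have hinj : Set.InjOn (fun t => t - m) ((Finset.range T).filter fun t => m ≤ t) := by
      intro a ha b hb hab
      have h1 := (Finset.mem_filter.1 ha).2
      have h2 := (Finset.mem_filter.1 hb).2
      dsimp only at hab
      omega
    rw [← Finset.sum_image (f := fun s : ℕ => C * ((s : ℝ) + 1) ^ (-p)) hinj]
    refine Finset.sum_le_sum_of_subset_of_nonneg ?_ fun s _ _ => by positivity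
    intro s hs
    obtain ⟨t, ht, rfl⟩ := Finset.mem_image.1 hs
    have := Finset.mem_range.1 (Finset.mem_filter.1 ht).1
    rw [Finset.mem_range]
    omega

/-! ### The two regret bounds on the good event -/

theorem not_exploreWeak_of_stronglyObservable (hcov : ∀ j, ∃ i, j ∈ obsSet sd i)
    (hs : StronglyObservable sd) {s : State K} (h : 1 < s.active.card) :
    ¬ ExploreWeak sd c σ D s := fun hE => by
  have := hE.1
  rw [weakPart, strongPart_eq_of_stronglyObservable hcov hs h] at this
  simp at this

theorem weakRounds_eq_zero (hK : 0 < K) (hσ : 0 ≤ σ) (hcov : ∀ j, ∃ i, j ∈ obsSet sd i)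
    (hs : StronglyObservable sd) (n : ℕ) : weakRounds sd c ord σ D δ x n = 0 := by
  induction n with
  | zero => rfl
  | succ n ih =>
    rw [weakRounds_succ_of_not, ih]
    rintro ⟨h1, hE⟩
    have := (run_active_nonempty (sd := sd) (c := c) (ord := ord) (D := D) (δ := δ) (x := x)
      hK hσ n).card_pos
    exact not_exploreWeak_of_stronglyObservable hcov hs (by omega) hE

theorem log_ratio_ge_one (hK : 1 < K) (hδ0 : 0 < δ) (hδ1 : δ < 1) {T : ℕ} (hT : 0 < T) :
    1 ≤ Real.log (2 * K * T / δ) := by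
  have hKr : (2 : ℝ) ≤ K := by exact_mod_cast hK
  have hTr : (1 : ℝ) ≤ T := by exact_mod_cast hT
  rw [Real.le_log_iff_exp_le (by positivity), le_div_iff₀ hδ0]
  have := Real.exp_one_lt_d9
  have h1 : (4 : ℝ) ≤ 2 * K * T := by nlinarith
  nlinarith [Real.exp_pos 1]

/-- Weak exploration never occurs, and at time `τ` every active action has at least `qτ/2`
observations. A round `t` belongs to a phase that started no earlier than `t + 1 - 2K`, which
explains the shift and the term `2KD`. -/
theorem regret_le_strong (hK : 1 < K) (hσ : 0 ≤ σ) (hD : 0 < D) (hδ0 : 0 < δ) (hδ1 : δ < 1)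
    (hc : IsMaximinRule sd c)
    (hord : IsPlayOrder ord) (hcov : ∀ j, ∃ i, j ∈ obsSet sd i) (hs : StronglyObservable sd)
    (hθ : ∀ i, θ i ∈ Set.Icc 0 D) {T : ℕ} (hT : 0 < T)
    (hgood : GoodEvent sd c ord σ D δ θ T x) :
    regret sd c ord σ D δ x θ T ≤ 2 * (K : ℝ) * D +
      80 * σ * Real.sqrt ((independenceNumber sd : ℝ) * (T : ℝ) *
        (6 * Real.log (K : ℝ) * Real.log (2 * (K : ℝ) * (T : ℝ) / δ))) := by
  have hK0 : 0 < K := by omega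
  set L := Real.log (2 * (K : ℝ) * (T : ℝ) / δ) with hL
  have hL1 : 1 ≤ L := log_ratio_ge_one hK hδ0 hδ1 hT
  have hlogK : 0 < Real.log K := Real.log_pos (by exact_mod_cast hK)
  have hκ : (0 : ℝ) < independenceNumber sd := by exact_mod_cast independenceNumber_pos hK0
  set q : ℝ := 1 / (50 * independenceNumber sd * Real.log K) with hq
  have hq0 : 0 < q := by positivity
  set C : ℝ := 4 * σ * Real.sqrt (12 * L / q) with hC
  have hC0 : 0 ≤ C := by positivity
  have hf0 : ∀ t : ℕ, 0 ≤ (if t < 2 * K then D else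
      C * ((t : ℝ) + 1 - (2 * K : ℕ)) ^ (-(1 / 2) : ℝ)) := by
    intro t
    split_ifs with h
    · exact hD.le
    · have : ((2 * K : ℕ) : ℝ) ≤ t := by exact_mod_cast not_lt.1 h
      exact mul_nonneg hC0 (Real.rpow_nonneg (by linarith) _)
  obtain ⟨n, -, hn⟩ := exists_regret_le hK0 hσ hD hc hord hθ hT hgood hf0 (by
    intro n hnT h1 hE i hi t ht1 ht2
    split_ifs with h
    · exact gap_le hK0 hθ i
    · set τ := (run sd c ord σ D δ x n).played.length with hτ
      have hτ1 : 1 ≤ τ := by omega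
      have hn1 : 1 ≤ n := by
        by_contra h0
        have : n = 0 := by omega
        subst this
        simp [run] at hτ
        omega
      have hcard : 1 < (run sd c ord σ D δ x n).active.card := by
        have := Finset.card_pos.2 ⟨i, hi⟩
        omega
      have hAS := strongPart_eq_of_stronglyObservable hcov hs hcard
      have hτr : (0 : ℝ) < τ := by exact_mod_cast hτ1
      have h2 := gap_le_of_active hK0 hσ hδ0 hδ1 hgood hn1
        ((le_length_run hK0 hσ hc hord n).trans_lt hnT) h1 (M := q * τ / 2) (by positivity)
        (fun j hj => by
          have h3 := rounds_le_numObs_strong hK0 hσ hc hord hq0.le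
            (fun A hA _ => maximinValue_strong_ge hc hcov hs hA) n h1 (hAS.symm ▸ hj)
          rw [weakRounds_eq_zero hK0 hσ hcov hs, Nat.cast_zero, sub_zero] at h3
          linarith) hi
      refine h2.trans ?_
      have ht' : ((2 * K : ℕ) : ℝ) ≤ t := by exact_mod_cast not_lt.1 h
      have hu : 0 < (t : ℝ) + 1 - (2 * K : ℕ) := by linarith
      have huτ : (t : ℝ) + 1 - (2 * K : ℕ) ≤ τ := by
        have : ((t + 1 : ℕ) : ℝ) ≤ ((τ + 2 * K : ℕ) : ℝ) := by exact_mod_cast ht2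
        push_cast at this ⊢
        linarith
      rw [← hL, Real.rpow_neg hu.le, ← Real.sqrt_eq_rpow, ← div_eq_mul_inv, hC,
        mul_div_assoc (4 * σ), ← Real.sqrt_div (by positivity)]
      refine mul_le_mul_of_nonneg_left (Real.sqrt_le_sqrt ?_) (by positivity)
      have h4 : 6 * L / (q * τ / 2) = 12 * L / q / τ := by field_simp; norm_num
      rw [h4]
      gcongr)
  rw [weakRounds_eq_zero hK0 hσ hcov hs, Nat.cast_zero, mul_zero, zero_add] at hn
  refine hn.trans ((sum_range_ite_le hD.le hC0 (by norm_num) (by norm_num) le_rfl T).trans ?_)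
  refine add_le_add (by push_cast; exact le_rfl) (le_of_eq ?_)
  rw [show (1 : ℝ) - 1 / 2 = 1 / 2 by norm_num, ← Real.sqrt_eq_rpow, hC]
  -- Here `12 · 50 = 10² · 6`. With the factor `8` from the radii and the summation this yields
  -- `80`.
  have h5 : Real.sqrt (12 * L / q) * Real.sqrt T = 10 * Real.sqrt ((independenceNumber sd : ℝ) *
      (T : ℝ) * (6 * Real.log (K : ℝ) * L)) := by
    rw [← Real.sqrt_mul (by positivity), show (10 : ℝ) = Real.sqrt (10 ^ 2) from
      (Real.sqrt_sq (by norm_num)).symm, ← Real.sqrt_mul (by positivity)]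
    congr 1
    rw [hq]
    field_simp
    norm_num
  calc 4 * σ * Real.sqrt (12 * L / q) * (Real.sqrt T / (1 / 2))
      = 8 * σ * (Real.sqrt (12 * L / q) * Real.sqrt T) := by ring
    _ = _ := by rw [h5]; ring

/-- In a phase that explores with the active set and starts late enough, all active actions have
been observed often. -/
theorem le_numObs_of_not_exploreWeak (hσ : 0 ≤ σ) (hD : 0 < D) (hc : IsMaximinRule sd c)
    (hord : IsPlayOrder ord) (hcov : ∀ j, ∃ i, j ∈ obsSet sd i) (hw : WeaklyObservable sd) {n : ℕ}
    (h1 : (run sd c ord σ D δ x n).active.card ≠ 1)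
    (hE : ¬ ExploreWeak sd c σ D (run sd c ord σ D δ x n)) {τ : ℝ}
    (hτ : τ = (run sd c ord σ D δ x n).played.length)
    (hτ1 : 125 * σ ^ 2 * (K : ℝ) ^ 3 / D ^ 2 ≤ τ) (hτ2 : 12 * (K : ℝ) ^ 3 ≤ τ) {j : Fin K}
    (hj : j ∈ (run sd c ord σ D δ x n).active) :
    (σ * τ / (weakDominationNumber sd * D)) ^ ((2 : ℝ) / 3) ≤
      numObs sd (run sd c ord σ D δ x n).played j := by
  have hK := three_le_of_weaklyObservable hw
  have hK0 : 0 < K := by omega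
  have hK3 : (3 : ℝ) ≤ K := by exact_mod_cast hK
  have hρ1 : (1 : ℝ) ≤ weakDominationNumber sd := by exact_mod_cast weakDominationNumber_pos hcov hw
  have hρK : (weakDominationNumber sd : ℝ) ≤ K := by exact_mod_cast weakDominationNumber_le hcov
  set ρ : ℝ := (weakDominationNumber sd : ℝ) with hρ
  have hτ0 : 0 < τ := lt_of_lt_of_le (by positivity) hτ2
  set y := (σ * τ / D) ^ ((2 : ℝ) / 3) with hy
  have hy0 : 0 ≤ y := by positivity
  have hyρ : (σ * τ / (ρ * D)) ^ ((2 : ℝ) / 3) ≤ y := by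
    refine Real.rpow_le_rpow (by positivity) ?_ (by norm_num)
    gcongr
    nlinarith
  have hy3 : y ^ 3 = (σ * τ / D) ^ 2 := by
    rw [hy, ← Real.rpow_natCast, ← Real.rpow_mul (by positivity)]
    norm_num
  -- Cubing turns this into the assumption `hτ1`; the constant `125` is `5³`.
  have hyτ : y ≤ τ / (5 * K) := by
    refine le_of_pow_le_pow_left₀ (n := 3) (by norm_num) (by positivity) ?_
    rw [hy3]
    rw [div_le_iff₀ (by positivity)] at hτ1
    rw [div_pow, div_pow, div_le_div_iff₀ (by positivity) (by positivity)]
    have := mul_le_mul_of_nonneg_left hτ1 (sq_nonneg τ)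
    nlinarith
  -- Members of the strong part are observed in all other phases.
  have hS : ∀ s ∈ strongPart sd (run sd c ord σ D δ x n).active,
      y ≤ numObs sd (run sd c ord σ D δ x n).played s := by
    intro s hs
    have h2 := rounds_le_numObs_strong hK0 hσ hc hord (q := 1 / (K : ℝ)) (by positivity)
      (fun A _ hA => inv_le_maximinValue_strongPart hc hA) n h1 hs
    have h3 := weakRounds_succ_le (σ := σ) (D := D) (δ := δ) (x := x) hσ hD hc hord hcov hw n
    rw [weakRounds_succ_of_not fun h => hE h.2, ← hτ, ← hy, ← hρ] at h3
    rw [← hτ, one_div, inv_mul_le_iff₀ (by positivity)] at h2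
    have h4 : ρ ^ ((1 : ℝ) / 3) ≤ K := by
      calc ρ ^ ((1 : ℝ) / 3) ≤ ρ ^ (1 : ℝ) :=
            Real.rpow_le_rpow_of_exponent_le hρ1 (by norm_num)
        _ = ρ := Real.rpow_one ρ
        _ ≤ K := hρK
    have h5 : ρ ^ ((1 : ℝ) / 3) * y ≤ τ / 5 := by
      calc ρ ^ ((1 : ℝ) / 3) * y ≤ K * (τ / (5 * K)) := by gcongr
        _ = τ / 5 := by field_simp
    have h6 : 2 * (K : ℝ) * (K - 1) ≤ τ / 6 := by
      have : (K : ℝ) ^ 2 ≤ (K : ℝ) ^ 3 := pow_le_pow_right₀ (by linarith) (by norm_num)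
      nlinarith
    -- Weak rounds take at most `2τ/5 + τ/6`, so at least `13τ/30` rounds remain. At the rate `1 /
    -- (2K)` they give `13τ/(60K)` observations, which is at least `τ/(5K)`.
    refine hyτ.trans ?_
    rw [div_le_iff₀ (by positivity)]
    linarith
  by_cases hjS : j ∈ strongPart sd (run sd c ord σ D δ x n).active
  · exact hyρ.trans (hS j hjS)
  · have hjW : j ∈ weakPart sd (run sd c ord σ D δ x n).active := mem_weakPart.2 ⟨hj, hjS⟩
    by_contra hcon
    push Not at hcon
    -- A weak action with too few observations would lag behind the strong part by `hS` and stay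
    -- below `γ` because `α ≥ 1/ρ`. Then the phase would be a weak exploration.
    refine hE ⟨⟨j, hjW⟩, ?_, j, hjW, hcon.trans_le ?_⟩
    · refine (Finset.inf_le (f := fun i =>
        (numObs sd (run sd c ord σ D δ x n).played i : ℕ∞)) hjW).trans_lt ?_
      rw [Finset.lt_inf_iff (ENat.natCast_lt_top _)]
      intro s hs
      have := (hcon.trans_le hyρ).trans_le (hS s hs)
      exact_mod_cast this
    · rw [gammaThreshold, ← hτ]
      refine Real.rpow_le_rpow (by positivity) ?_ (by norm_num)
      have hα := inv_weakDominationNumber_le_alpha hσ hc hcov hw h1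
      calc σ * τ / (ρ * D) = σ * (1 / ρ) * τ / D := by field_simp
        _ ≤ _ := by gcongr

theorem regret_le_weak (hσ : 0 ≤ σ) (hD : 0 < D) (hδ0 : 0 < δ) (hδ1 : δ < 1)
    (hc : IsMaximinRule sd c)
    (hord : IsPlayOrder ord) (hcov : ∀ j, ∃ i, j ∈ obsSet sd i) (hw : WeaklyObservable sd)
    (hθ : ∀ i, θ i ∈ Set.Icc 0 D) {T : ℕ} (hT : 0 < T)
    (hgood : GoodEvent sd c ord σ D δ θ T x) :
    regret sd c ord σ D δ x θ T ≤
      ((weakDominationNumber sd : ℝ) * D) ^ ((1 : ℝ) / 3) * (σ * (T : ℝ)) ^ ((2 : ℝ) / 3) *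
        (7 * Real.sqrt (6 * Real.log (2 * (K : ℝ) * (T : ℝ) / δ))) +
          125 * σ ^ 2 * (K : ℝ) ^ 3 / D + 13 * (K : ℝ) ^ 3 * D := by
  have hK := three_le_of_weaklyObservable hw
  have hK0 : 0 < K := by omega
  have hK3 : (3 : ℝ) ≤ K := by exact_mod_cast hK
  set L := Real.log (2 * (K : ℝ) * (T : ℝ) / δ) with hL
  have hL1 : 1 ≤ L := log_ratio_ge_one (by omega) hδ0 hδ1 hT
  have hρ1 : (1 : ℝ) ≤ weakDominationNumber sd := by exact_mod_cast weakDominationNumber_pos hcov hw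
  set ρ : ℝ := (weakDominationNumber sd : ℝ) with hρ
  -- Rounds before `B0` are charged `D` each. The first two terms meet the requirements of
  -- `le_numObs_of_not_exploreWeak` even after a loss of up to `2K` rounds; the subtracted `2K²`
  -- makes room for the overhead `2K(K - 1)` of weak exploration.
  set B0 : ℝ := 125 * σ ^ 2 * (K : ℝ) ^ 3 / D ^ 2 + 13 * (K : ℝ) ^ 3 - 2 * (K : ℝ) ^ 2 with hB0
  have hKsq : 3 * (K : ℝ) ^ 2 ≤ (K : ℝ) ^ 3 := by nlinarith [sq_nonneg (K : ℝ)]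
  have hKlin : 3 * (K : ℝ) ≤ (K : ℝ) ^ 2 := by nlinarith
  have hσK : 0 ≤ 125 * σ ^ 2 * (K : ℝ) ^ 3 / D ^ 2 := by positivity
  have hB00 : 0 ≤ B0 := by linarith
  set B : ℕ := ⌈B0⌉₊ with hB
  have hBle : (B : ℝ) ≤ B0 + 1 := (Nat.ceil_lt_add_one hB00).le
  have hBge : B0 ≤ B := Nat.le_ceil B0
  have hKB : 2 * K ≤ B := by
    have : ((2 * K : ℕ) : ℝ) ≤ B := by push_cast; linarith
    exact_mod_cast this
  set C : ℝ := 4 * Real.sqrt (6 * L) * (σ ^ ((2 : ℝ) / 3) * (ρ * D) ^ ((1 : ℝ) / 3)) with hC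
  have hC0 : 0 ≤ C := by positivity
  have hf0 : ∀ t : ℕ, 0 ≤ (if t < B then D else
      C * ((t : ℝ) + 1 - (2 * K : ℕ)) ^ (-(1 / 3) : ℝ)) := by
    intro t
    split_ifs with h
    · exact hD.le
    · have : ((2 * K : ℕ) : ℝ) ≤ t := by exact_mod_cast hKB.trans (not_lt.1 h)
      exact mul_nonneg hC0 (Real.rpow_nonneg (by linarith) _)
  obtain ⟨n, hnT, hn⟩ := exists_regret_le hK0 hσ hD hc hord hθ hT hgood hf0 (by
    intro n hnT h1 hE i hi t ht1 ht2
    split_ifs with h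
    · exact gap_le hK0 hθ i
    · obtain ⟨τ, hτ⟩ : ∃ τ : ℝ, τ = (run sd c ord σ D δ x n).played.length := ⟨_, rfl⟩
      have hBt : (B : ℝ) ≤ t := by exact_mod_cast not_lt.1 h
      have hKt : ((2 * K : ℕ) : ℝ) ≤ t := by exact_mod_cast hKB.trans (not_lt.1 h)
      have hu : 0 < (t : ℝ) + 1 - (2 * K : ℕ) := by linarith
      have huτ : (t : ℝ) + 1 - (2 * K : ℕ) ≤ τ := by
        have : ((t + 1 : ℕ) : ℝ) ≤
            (((run sd c ord σ D δ x n).played.length + 2 * K : ℕ) : ℝ) := by exact_mod_cast ht2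
        rw [hτ]
        push_cast at this ⊢
        linarith
      have hτB : B0 - 2 * K ≤ τ := by push_cast at huτ; linarith
      have hτ0 : 0 < τ := hu.trans_le huτ
      have hn1 : 1 ≤ n := by
        by_contra h0
        have : n = 0 := by omega
        subst this
        simp [run] at hτ
        linarith
      have hobs := fun j hj => le_numObs_of_not_exploreWeak (j := j) hσ hD hc hord hcov hw h1 hE hτ
        (by linarith) (by linarith) hj
      have hnT' : n < T := (le_length_run hK0 hσ hc hord n).trans_lt hnT
      -- For `σ = 0` the lower bound on the counts degenerates to zero and cannot serve as `M`; one
      -- observation is then enough to make the gap zero.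
      rcases hσ.eq_or_lt with h0 | hσ0
      · have h2 := gap_le_of_active hK0 hσ hδ0 hδ1 hgood hn1 hnT' h1 (M := 1) one_pos
          (fun j _ => by exact_mod_cast numObs_run_pos (by omega) hc hord hcov hn1 j) hi
        rw [← h0, mul_zero, zero_mul] at h2
        exact h2.trans (mul_nonneg hC0 (Real.rpow_nonneg hu.le _))
      · have h2 := gap_le_of_active hK0 hσ hδ0 hδ1 hgood hn1 hnT' h1
          (Real.rpow_pos_of_pos (by positivity) _) hobs hi
        refine h2.trans ?_
        have hsq : Real.sqrt ((σ * τ / (ρ * D)) ^ ((2 : ℝ) / 3)) =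
            (σ * τ / (ρ * D)) ^ ((1 : ℝ) / 3) := by
          rw [Real.sqrt_eq_rpow, ← Real.rpow_mul (by positivity)]
          norm_num
        have hσ3 : σ = σ ^ ((2 : ℝ) / 3) * σ ^ ((1 : ℝ) / 3) := by
          rw [← Real.rpow_add hσ0]; norm_num
        have e1 : 0 < σ ^ ((1 : ℝ) / 3) := Real.rpow_pos_of_pos hσ0 _
        have e2 : 0 < τ ^ ((1 : ℝ) / 3) := Real.rpow_pos_of_pos hτ0 _
        have e3 : 0 < (ρ * D) ^ ((1 : ℝ) / 3) := Real.rpow_pos_of_pos (by positivity) _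
        rw [Real.sqrt_div (by positivity), hsq, Real.div_rpow (by positivity) (by positivity),
          Real.mul_rpow hσ hτ0.le]
        have h3 : 4 * σ * (Real.sqrt (6 * L) /
            (σ ^ ((1 : ℝ) / 3) * τ ^ ((1 : ℝ) / 3) / (ρ * D) ^ ((1 : ℝ) / 3))) =
            C * τ ^ (-(1 / 3) : ℝ) := by
          rw [Real.rpow_neg hτ0.le, hC]
          nth_rewrite 1 [hσ3]
          field_simp
        rw [h3]
        refine mul_le_mul_of_nonneg_left ?_ hC0
        exact Real.rpow_le_rpow_of_nonpos hu huτ (by norm_num))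
  have hsum := sum_range_ite_le hD.le hC0 (p := 1 / 3) (by norm_num) (by norm_num) hKB T
  have hW := weakRounds_succ_le (σ := σ) (D := D) (δ := δ) (x := x) hσ hD hc hord hcov hw n
  set P := (ρ * D) ^ ((1 : ℝ) / 3) * (σ * (T : ℝ)) ^ ((2 : ℝ) / 3) with hP
  have hP0 : 0 ≤ P := by positivity
  have hTr : ((run sd c ord σ D δ x n).played.length : ℝ) ≤ T := by exact_mod_cast hnT.le
  have hW2 : D * (weakRounds sd c ord σ D δ x (n + 1) : ℝ) ≤ 2 * P + D * (2 * K * (K - 1)) := by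
    have h1 : (weakRounds sd c ord σ D δ x (n + 1) : ℝ) ≤
        2 * ρ ^ ((1 : ℝ) / 3) * (σ * T / D) ^ ((2 : ℝ) / 3) + 2 * K * (K - 1) := by
      refine hW.trans ?_
      gcongr
    have h2 : D * (2 * ρ ^ ((1 : ℝ) / 3) * (σ * T / D) ^ ((2 : ℝ) / 3)) = 2 * P := by
      have hD3 : D = D ^ ((1 : ℝ) / 3) * D ^ ((2 : ℝ) / 3) := by
        rw [← Real.rpow_add hD]; norm_num
      have e1 : 0 < D ^ ((2 : ℝ) / 3) := Real.rpow_pos_of_pos hD _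
      rw [hP, Real.mul_rpow (by positivity) hD.le, Real.div_rpow (by positivity) hD.le]
      nth_rewrite 1 [hD3]
      field_simp
    have h3 := mul_le_mul_of_nonneg_left h1 hD.le
    rw [mul_add, h2] at h3
    exact h3
  have hC2 : C * ((T : ℝ) ^ (1 - 1 / 3 : ℝ) / (1 - 1 / 3)) = 6 * Real.sqrt (6 * L) * P := by
    rw [hP, hC, Real.mul_rpow hσ (Nat.cast_nonneg T), show (1 : ℝ) - 1 / 3 = 2 / 3 by norm_num]
    ring
  -- Since `L ≥ 1`, the cost `2P` of weak exploration is at most `√(6L) P`. Added to the `6 √(6L) P`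
  -- from the other phases, it gives the factor `7`.
  have hs2 : 2 ≤ Real.sqrt (6 * L) := Real.le_sqrt_of_sq_le (by linarith)
  have hPs : 2 * P ≤ Real.sqrt (6 * L) * P := mul_le_mul_of_nonneg_right hs2 hP0
  have hBD : (B : ℝ) * D ≤ 125 * σ ^ 2 * (K : ℝ) ^ 3 / D + 13 * (K : ℝ) ^ 3 * D -
      2 * (K : ℝ) ^ 2 * D + D := by
    refine (mul_le_mul_of_nonneg_right hBle hD.le).trans (le_of_eq ?_)
    rw [hB0]
    field_simp
  rw [hC2] at hsum
  have hDK : D * 1 ≤ D * K := mul_le_mul_of_nonneg_left (by linarith) hD.le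
  nlinarith

/-- Only subadditivity is used, so neither event has to be measurable. -/
theorem one_sub_le_measureReal {Ω : Type*} [MeasurableSpace Ω] {μ : Measure Ω}
    [IsProbabilityMeasure μ] {p q : Ω → Prop} {δ : ℝ} (hδ : 0 ≤ δ)
    (h : μ {ω | ¬ p ω} ≤ ENNReal.ofReal δ) (hpq : ∀ ω, p ω → q ω) :
    1 - δ ≤ μ.real {ω | q ω} := by
  have h1 : μ.real {ω | ¬ p ω} ≤ δ := ENNReal.toReal_le_of_le_ofReal hδ h
  have h2 : μ.real (Set.univ : Set Ω) ≤ μ.real ({ω | q ω} ∪ {ω | ¬ p ω}) := by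
    refine measureReal_mono fun ω _ => ?_
    by_cases hp : p ω
    · exact Or.inl (hpq ω hp)
    · exact Or.inr hp
  rw [probReal_univ] at h2
  linarith [measureReal_union_le (μ := μ) {ω | q ω} {ω | ¬ p ω}]

end Regret

end SideObs

/-! ### From the good event to the probability bounds -/

theorem mainTheorem6 {Ω : Type*} [MeasurableSpace Ω] (μ : Measure Ω) [IsProbabilityMeasure μ]
    (K : ℕ) (hK : 0 < K) (T : ℕ) (σ D δ : ℝ) (hσ : 0 ≤ σ) (hD : 0 < D)
    (hδ0 : 0 < δ) (hδ1 : δ < 1)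
    (sd : Fin K → Fin K → ℝ≥0∞)
    (huniform : ∀ i j, sd i j = ENNReal.ofReal σ ∨ sd i j = ⊤)
    (hobs : ∀ j, ∃ i, sd i j ≤ ENNReal.ofReal σ)
    (θ : Fin K → ℝ) (hθ : ∀ i, θ i ∈ Set.Icc 0 D)
    (X : ℕ → Fin K → Fin K → Ω → ℝ) (hX : SideObs.IsEnvironment μ sd θ X)
    (c : Finset (Fin K) → Finset (Fin K) → Fin K → ℝ) (hc : SideObs.IsMaximinRule sd c)
    (ord : ℕ → (Fin K → ℕ) → List (Fin K)) (hord : SideObs.IsPlayOrder ord) :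
    (SideObs.WeaklyObservable sd →
      1 - δ ≤ μ.real {ω |
        SideObs.regret sd c ord σ D δ (fun t i j => X t i j ω) θ T ≤
          ((SideObs.weakDominationNumber sd : ℝ) * D) ^ ((1 : ℝ) / 3) *
              (σ * (T : ℝ)) ^ ((2 : ℝ) / 3) *
              (7 * Real.sqrt (6 * Real.log (2 * (K : ℝ) * (T : ℝ) / δ))) +
            125 * σ ^ 2 * (K : ℝ) ^ 3 / D + 13 * (K : ℝ) ^ 3 * D}) ∧
    (SideObs.StronglyObservable sd →
      1 - δ ≤ μ.real {ω |
        SideObs.regret sd c ord σ D δ (fun t i j => X t i j ω) θ T ≤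
          2 * (K : ℝ) * D +
            80 * σ * Real.sqrt ((SideObs.independenceNumber sd : ℝ) * (T : ℝ) *
              (6 * Real.log (K : ℝ) * Real.log (2 * (K : ℝ) * (T : ℝ) / δ)))}) := by
  have hcov : ∀ j, ∃ i, j ∈ SideObs.obsSet sd i := fun j => by
    obtain ⟨i, hi⟩ := hobs j
    exact ⟨i, by simpa [SideObs.obsSet] using hi.trans_lt ENNReal.ofReal_lt_top⟩
  have hregret0 : ∀ ω, (T = 0 ∨ K = 1) →
      SideObs.regret sd c ord σ D δ (fun t i j => X t i j ω) θ T = 0 := by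
    rintro ω (rfl | rfl)
    · simp [SideObs.regret, SideObs.actions]
    · obtain ⟨b, -, hg⟩ := SideObs.exists_best hK θ
      simp [SideObs.regret, hg, Subsingleton.elim b 0]
  have hgood := fun hK1 : 1 < K => SideObs.measure_not_goodEvent_le (D := D) hK1 hσ hδ0 hδ1 hc hord
    hcov hX huniform T
  constructor
  · intro hw
    have hK3 := SideObs.three_le_of_weaklyObservable hw
    refine SideObs.one_sub_le_measureReal hδ0.le (hgood (by omega)) fun ω hω => ?_
    rcases Nat.eq_zero_or_pos T with hT | hT
    · rw [hregret0 ω (Or.inl hT)]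
      positivity
    · exact SideObs.regret_le_weak hσ hD hδ0 hδ1 hc hord hcov hw hθ hT hω
  · intro hs
    by_cases h : T = 0 ∨ K = 1
    -- For `T = 0` or `K = 1` the regret vanishes identically and the bound is nonnegative, so no
    -- good event is needed; its probability estimate assumes `K > 1`.
    · refine SideObs.one_sub_le_measureReal (p := fun _ => True) hδ0.le (by simp) fun ω _ => ?_
      rw [hregret0 ω h]
      positivity
    · refine SideObs.one_sub_le_measureReal hδ0.le (hgood (by omega)) fun ω hω => ?_
      exact SideObs.regret_le_strong (by omega) hσ hD hδ0 hδ1 hc hord hcov hs hθ (by omega) hω
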